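/- Let $d\ge 3$, $m>0$, $N=2^{\lfloor (d+1)/2\rfloor}$, and let $\alpha_1,\dots,\alpha_d,\beta$ be Hermitian $N\times N$ complex matrices satisfying $$\alpha_j\alpha_k+\alpha_k\alpha_j=2\delta_{jk}I,\qquad \alpha_j\beta+\beta\alpha_j=0,\qquad \beta^2=I .$$ Let $H_D=-i\sum_{j=1}^d\alpha_j\partial_j+m\beta$ be the free Dirac operator, and let $H=H_D+V$, where the following Assumption (HS) holds: $V:\mathbb{R}^d\to\mathbb{C}^{N\times N}$ is a Hermitian matrix-valued potential, $V\in C^\infty(\mathbb{R}^d\setminus\{0\})$, and $V$ is bounded outside any ball centred at the origin; $H$ maps $C_c^\infty(\mathbb{R}^d;\mathbb{C}^N)$ into $L^2(\mathbb{R}^d;\mathbb{C}^N)$ and is essentially self-adjoint there; and its self-adjoint closure in $L^2(\mathbb{R}^d;\mathbb{C}^N)$, again denoted by $H$, has domain $\mathcal{D}(H)\subseteq H^1(\mathbb{R}^d;\mathbb{C}^N)$. Write $|A|$ for the operator norm of a matrix $A$ on $\mathbb{C}^N$ with its Euclidean norm, $|\nabla V|=\big(\sum_{j=1}^d|\partial_jV|^2\big)^{1/2}$,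 $[A,B]=AB-BA$ and $\{A,B\}=AB+BA$. Suppose that there are positive constants $C_1,C_2,C_3,C_4$ such that, for all $x\ne 0$ and all $j=1,\dots,d$, $$|\nabla V(x)|\le\frac{C_1}{|x|^2},\qquad |[\alpha_j,V(x)]|\le\frac{C_2}{|x|},\qquad \big|(x\cdot\nabla)\{V,\beta\}(x)\big|\le\frac{C_3}{|x|^2},\qquad |[\beta,V(x)]|\le\frac{C_4}{|x|^2}.$$ If $$\frac{4C_1}{d-2}+C_2+\frac{2mC_4}{d-2}+\frac{2mC_3}{(d-2)^2}<1,$$ then $H$ has no eigenvalues, that is, $\sigma_p(H)=\varnothing$. -/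

import Mathlib

open MeasureTheory
open scoped ContDiff

/-- Euclidean space `ℝ^d`. -/
abbrev RSpace (d : ℕ) : Type := EuclideanSpace ℝ (Fin d)

/-- The spinor dimension `N = 2^⌊(d+1)/2⌋`. -/
abbrev spinorDim (d : ℕ) : ℕ := 2 ^ ((d + 1) / 2)

/-- Spinors, `ℂ^N` with its Euclidean norm. -/
abbrev Spinor (d : ℕ) : Type := EuclideanSpace ℂ (Fin (spinorDim d))

/-- Complex `N × N` matrices. -/
abbrev SpinMat (d : ℕ) : Type := Matrix (Fin (spinorDim d)) (Fin (spinorDim d)) ℂ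

/-- The Hilbert space `L²(ℝ^d; ℂ^N)`. -/
abbrev SpinorL2 (d : ℕ) : Type := Lp (Spinor d) 2 (volume : Measure (RSpace d))

/-- Action of a matrix on a spinor. -/
noncomputable def act {d : ℕ} (A : SpinMat d) (v : Spinor d) : Spinor d :=
  Matrix.toEuclideanCLM (n := Fin (spinorDim d)) (𝕜 := ℂ) A v

/-- The norm `|A|` of a matrix: its operator norm on Euclidean `ℂ^N`. -/
noncomputable def matNorm {d : ℕ} (A : SpinMat d) : ℝ :=
  ‖Matrix.toEuclideanCLM (n := Fin (spinorDim d)) (𝕜 := ℂ) A‖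

/-- The `j`-th partial derivative of a vector-valued function. -/
noncomputable def partialD {d : ℕ} {F : Type*} [NormedAddCommGroup F] [NormedSpace ℝ F]
    (j : Fin d) (φ : RSpace d → F) (x : RSpace d) : F :=
  fderiv ℝ φ x (EuclideanSpace.single j (1 : ℝ))

/-- The `j`-th partial derivative of a matrix-valued function, entry by entry. -/
noncomputable def matPartialD {d : ℕ} (j : Fin d) (W : RSpace d → SpinMat d) (x : RSpace d) :
    SpinMat d :=
  Matrix.of fun k l => partialD j (fun y => W y k l) x

/-- `|∇W(x)| = (∑_j |∂_j W(x)|²)^{1/2}`. -/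
noncomputable def gradNorm {d : ℕ} (W : RSpace d → SpinMat d) (x : RSpace d) : ℝ :=
  Real.sqrt (∑ j, matNorm (matPartialD j W x) ^ 2)

/-- `((x·∇)W)(x) = ∑_j x_j ∂_j W(x)`. -/
noncomputable def eulerD {d : ℕ} (W : RSpace d → SpinMat d) (x : RSpace d) : SpinMat d :=
  ∑ j, ((x j : ℝ) : ℂ) • matPartialD j W x

/-- Hermitian `N × N` matrices `α_1, …, α_d, β` with the Clifford relations
`{α_j, α_k} = 2 δ_{jk} I`, `{α_j, β} = 0`, `β² = I`. -/
structure IsDiracMatrices {d : ℕ} (α : Fin d → SpinMat d) (β : SpinMat d) : Prop where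
  alpha_hermitian : ∀ j, (α j).IsHermitian
  beta_hermitian : β.IsHermitian
  alpha_alpha : ∀ j k, α j * α k + α k * α j = if j = k then (2 : ℂ) • (1 : SpinMat d) else 0
  alpha_beta : ∀ j, α j * β + β * α j = 0
  beta_sq : β * β = 1

/-- `φ ∈ C_c^∞(ℝ^d; F)`. -/
def IsTestFunction {d : ℕ} {F : Type*} [NormedAddCommGroup F] [NormedSpace ℝ F]
    (φ : RSpace d → F) : Prop :=
  ContDiff ℝ ∞ φ ∧ HasCompactSupport φ

/-- The differential expression
`(H_D + V)φ = -i ∑_j α_j ∂_j φ + m β φ + V φ`. -/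
noncomputable def diracExpr {d : ℕ} (α : Fin d → SpinMat d) (β : SpinMat d) (m : ℝ)
    (V : RSpace d → SpinMat d) (φ : RSpace d → Spinor d) (x : RSpace d) : Spinor d :=
  (-Complex.I) • (∑ j, act (α j) (partialD j φ x)) + (m : ℂ) • act β (φ x) + act (V x) (φ x)

section WellDefined

variable {d : ℕ} (α : Fin d → SpinMat d) (β : SpinMat d) (m : ℝ) (V : RSpace d → SpinMat d)

theorem IsTestFunction.differentiable {F : Type*} [NormedAddCommGroup F] [NormedSpace ℝ F]
    {φ : RSpace d → F} (hφ : IsTestFunction φ) : Differentiable ℝ φ :=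
  hφ.1.differentiable (by simp)

theorem diracExpr_add {φ χ : RSpace d → Spinor d} (hφ : IsTestFunction φ)
    (hχ : IsTestFunction χ) :
    diracExpr α β m V (φ + χ) = diracExpr α β m V φ + diracExpr α β m V χ := by
  funext x
  have h : ∀ j, partialD j (φ + χ) x = partialD j φ x + partialD j χ x := by
    intro j
    simp [partialD, fderiv_add (hφ.differentiable x) (hχ.differentiable x)]
  simp only [diracExpr, act, h, Pi.add_apply, map_add, Finset.sum_add_distrib, smul_add]
  abel

theorem diracExpr_smul (c : ℂ) {φ : RSpace d → Spinor d} (hφ : IsTestFunction φ) :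
    diracExpr α β m V (c • φ) = c • diracExpr α β m V φ := by
  funext x
  have h : ∀ j, partialD j (c • φ) x = c • partialD j φ x := by
    intro j
    simp [partialD, fderiv_const_smul (hφ.differentiable x) c]
  simp only [diracExpr, act, h, Pi.smul_apply, map_smul, ← Finset.smul_sum, smul_add]
  simp only [smul_comm c]

theorem diracExpr_zero : diracExpr α β m V (0 : RSpace d → Spinor d) = 0 := by
  funext x
  have h : ∀ j, partialD j (0 : RSpace d → Spinor d) x = 0 := by
    intro j
    simp [partialD]
  simp [diracExpr, act, h]

/-- The graph in `L² × L²` of `H_D + V` acting on `C_c^∞(ℝ^d; ℂ^N)`. -/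
noncomputable def minimalDiracGraph : Submodule ℂ (SpinorL2 d × SpinorL2 d) where
  carrier := {p | ∃ φ : RSpace d → Spinor d, IsTestFunction φ ∧
    p.1 =ᵐ[volume] φ ∧ p.2 =ᵐ[volume] diracExpr α β m V φ}
  zero_mem' := by
    refine ⟨0, ⟨contDiff_const, HasCompactSupport.zero⟩, Lp.coeFn_zero _ _ _, ?_⟩
    rw [diracExpr_zero]
    exact Lp.coeFn_zero _ _ _
  add_mem' := by
    rintro p q ⟨φ, hφ, h1, h2⟩ ⟨χ, hχ, h3, h4⟩
    refine ⟨φ + χ, ⟨hφ.1.add hχ.1, hφ.2.add hχ.2⟩, ?_, ?_⟩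
    · exact (Lp.coeFn_add _ _).trans (h1.add h3)
    · rw [diracExpr_add α β m V hφ hχ]
      exact (Lp.coeFn_add _ _).trans (h2.add h4)
  smul_mem' := by
    rintro c p ⟨φ, hφ, h1, h2⟩
    refine ⟨c • φ, ⟨contDiff_const.smul hφ.1, hφ.2.smul_left (f := fun _ => c)⟩, ?_, ?_⟩
    · exact (Lp.coeFn_smul _ _).trans (h1.const_smul c)
    · rw [diracExpr_smul α β m V c hφ]
      exact (Lp.coeFn_smul _ _).trans (h2.const_smul c)

/-- The graph is the graph of a function. -/
theorem minimalDiracGraph_functional (p : SpinorL2 d × SpinorL2 d)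
    (hp : p ∈ minimalDiracGraph α β m V) (h0 : p.1 = 0) : p.2 = 0 := by
  obtain ⟨φ, hφ, h1, h2⟩ := hp
  have hz : φ =ᵐ[volume] (0 : RSpace d → Spinor d) := by
    rw [h0] at h1
    exact h1.symm.trans (Lp.coeFn_zero _ _ _)
  have hφ0 : φ = 0 :=
    Continuous.ae_eq_iff_eq volume hφ.1.continuous continuous_const |>.1 hz
  rw [hφ0, diracExpr_zero] at h2
  exact Lp.ext (h2.trans (Lp.coeFn_zero _ _ _).symm)

/-- `H_D + V` as an unbounded operator in `L²(ℝ^d; ℂ^N)` with domain `C_c^∞(ℝ^d; ℂ^N)`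
(those `φ` with `(H_D + V)φ ∈ L²`). -/
noncomputable def minimalDirac : SpinorL2 d →ₗ.[ℂ] SpinorL2 d :=
  (minimalDiracGraph α β m V).toLinearPMap

theorem minimalDirac_graph :
    (minimalDirac α β m V).graph = minimalDiracGraph α β m V :=
  Submodule.toLinearPMap_graph_eq _ (minimalDiracGraph_functional α β m V)

/-- The operator `H = H_D + V`: the closure of its restriction to `C_c^∞(ℝ^d; ℂ^N)`. -/
noncomputable def diracOp : SpinorL2 d →ₗ.[ℂ] SpinorL2 d :=
  (minimalDirac α β m V).closure

end WellDefined

/-- `f ∈ H¹(ℝ^d; ℂ^N)`: every weak partial derivative of `f ∈ L²` is in `L²`. -/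
def MemH1 {d : ℕ} (f : SpinorL2 d) : Prop :=
  ∀ j : Fin d, ∃ g : SpinorL2 d, ∀ η : RSpace d → ℝ, IsTestFunction η →
    ∫ x, partialD j η x • f x = -∫ x, η x • g x

/-- The standing assumption on `H = H_D + V`: `V` is Hermitian, smooth away from the origin and
bounded outside every ball around the origin; `H` maps `C_c^∞` to `L²` and is essentially
self-adjoint there, that is, its closure is self-adjoint; and the domain of this self-adjoint
operator is contained in `H¹`. -/
structure AssumptionHS {d : ℕ} (α : Fin d → SpinMat d) (β : SpinMat d) (m : ℝ)
    (V : RSpace d → SpinMat d) : Prop where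
  hermitian : ∀ x, x ≠ 0 → (V x).IsHermitian
  smooth : ∀ k l, ContDiffOn ℝ ∞ (fun x => V x k l) {0}ᶜ
  bounded : ∀ r : ℝ, 0 < r → ∃ M : ℝ, ∀ x, r ≤ ‖x‖ → matNorm (V x) ≤ M
  maps_test : ∀ φ : RSpace d → Spinor d, IsTestFunction φ →
    MemLp (diracExpr α β m V φ) 2 volume
  selfAdjoint : IsSelfAdjoint (diracOp α β m V)
  domain_le : ∀ f ∈ (diracOp α β m V).domain, MemH1 f

/-- The point spectrum (set of eigenvalues) of an unbounded operator. -/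
def pointSpectrum {E : Type*} [AddCommGroup E] [Module ℂ E] (A : E →ₗ.[ℂ] E) : Set ℂ :=
  {z | ∃ f : A.domain, (f : E) ≠ 0 ∧ A f = z • (f : E)}

open Filter Topology
open scoped Pointwise

/-! This is a virial argument resting on Hardy's inequality. Since the gradient of `V` is `O(|x|⁻²)`
and the punctured space is connected, `V` has a limit at infinity, approached at rate `C₁/|x|`
(`exists_limit_at_infinity`). The commutators of `V` with the Dirac matrices vanish at infinity, so
the limit commutes with these matrices. In dimension `2^⌊(d+1)/2⌋` they act irreducibly
(`eq_smul_of_commute_clifford`), so the limit is a real scalar `v₀`. Moving `v₀` into the spectral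
parameter `E` leaves `W = V - v₀`, for which both `W` and `x·∇W` are bounded by `C₁/|x|`.

Put `P = -i ∑ a_j ∂_j φ`. The Clifford relations give `‖P‖ = ‖∇φ‖`, so by Hardy `Wφ` and `(x·∇W)φ`
have norm at most `t‖P‖` with `t = 2C₁/(d-2)`. For an eigenfunction, commuting with the generator of
dilations formally gives `Re⟨φ, P - (x·∇W)φ⟩ = 0`. On the other hand `Re⟨P + Wφ, P - (x·∇W)φ⟩ ≥ (1 -
2t)‖P‖²`, while `P + Wφ = (E - m b)φ`. The virial identity kills the `E` part; `Re⟨bφ, P⟩` vanishes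
by anticommutation; and `m Re⟨bφ, (x·∇W)φ⟩`, half an anticommutator, is at most `2mC₃/(d-2)² ‖P‖²`.
Smallness forces `P = 0`, and Hardy then gives `φ = 0`.

An eigenfunction is only a graph-norm limit of test functions, and nothing is known about `x·∇` of
it. The estimates are therefore proved for test functions with an error controlled by the residual
`(H - E)φ` (`kinetic_sq_le`, `virial_le`). The virial identity is localised by a cutoff in `log|x|`
(`exists_dilation_cutoff`), which is removed only after the limit along the approximating sequence
(`tendsto_virial`). -/

/-! ### Integration by parts for test functions -/

theorem integrable_partialD {d : ℕ} {f : RSpace d → ℝ} (hf : ContDiff ℝ 1 f)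
    (hc : HasCompactSupport f) (j : Fin d) : Integrable (fun x => partialD j f x) :=
  ((hf.continuous_fderiv (by simp)).clm_apply continuous_const).integrable_of_hasCompactSupport
    (hc.fderiv_apply (𝕜 := ℝ) _)

theorem integral_partialD_eq_zero {d : ℕ} {f : RSpace d → ℝ} (hf : ContDiff ℝ 1 f)
    (hc : HasCompactSupport f) (j : Fin d) : ∫ x, partialD j f x = 0 := by
  have h1 := integrable_partialD hf hc j
  have h := integral_mul_fderiv_eq_neg_fderiv_mul_of_integrable (μ := (volume : Measure (RSpace d)))
    (f := fun _ => (1 : ℝ)) (g := f) (v := EuclideanSpace.single j (1 : ℝ)) (by simp)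
    (by simpa [partialD] using h1)
    (by simpa using hf.continuous.integrable_of_hasCompactSupport hc) (by simp)
    (fun x _ => hf.differentiable (by simp) x)
  simpa [partialD] using h

theorem IsTestFunction.partialD {d : ℕ} {F : Type*} [NormedAddCommGroup F] [NormedSpace ℝ F]
    {φ : RSpace d → F} (hφ : IsTestFunction φ) (j : Fin d) :
    IsTestFunction (partialD j φ) :=
  ⟨(hφ.1.fderiv_right (m := ∞) (by simp)).clm_apply contDiff_const, hφ.2.fderiv_apply (𝕜 := ℝ) _⟩

theorem IsTestFunction.partialD_comm {d : ℕ} {F : Type*} [NormedAddCommGroup F] [NormedSpace ℝ F]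
    {φ : RSpace d → F} (hφ : IsTestFunction φ) (j k : Fin d) (x : RSpace d) :
    _root_.partialD j (_root_.partialD k φ) x = _root_.partialD k (_root_.partialD j φ) x := by
  have hd : Differentiable ℝ (fderiv ℝ φ) :=
    (hφ.1.fderiv_right (m := ∞) (by simp)).differentiable (by simp)
  have h : ∀ i l, _root_.partialD i (_root_.partialD l φ) x =
      fderiv ℝ (fderiv ℝ φ) x (EuclideanSpace.single i 1) (EuclideanSpace.single l 1) := by
    intro i l
    unfold _root_.partialD
    rw [fderiv_clm_apply (hd x) (differentiableAt_const _)]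
    simp
  rw [h, h]
  exact ((contDiff_infty.1 hφ.1 2).contDiffAt.isSymmSndFDerivAt (by simp)) _ _

theorem IsTestFunction.continuous {d : ℕ} {F : Type*} [NormedAddCommGroup F] [NormedSpace ℝ F]
    {φ : RSpace d → F} (hφ : IsTestFunction φ) : Continuous φ := hφ.1.continuous

theorem partialD_re_inner {d : ℕ} {u v : RSpace d → Spinor d} {x : RSpace d}
    (hu : DifferentiableAt ℝ u x) (hv : DifferentiableAt ℝ v x) (j : Fin d) :
    partialD j (fun y => (inner ℂ (u y) (v y)).re) x =
      (inner ℂ (partialD j u x) (v x)).re + (inner ℂ (u x) (partialD j v x)).re := by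
  have h := Complex.reCLM.hasFDerivAt.comp x (hu.hasFDerivAt.inner ℂ hv.hasFDerivAt)
  have h2 : fderiv ℝ (fun y => (inner ℂ (u y) (v y)).re) x = _ := h.fderiv
  simp only [partialD, h2]
  simp [fderivInnerCLM_apply]
  ring

theorem partialD_clm_comp {d : ℕ} (M : Spinor d →L[ℂ] Spinor d) {u : RSpace d → Spinor d}
    {x : RSpace d} (hu : DifferentiableAt ℝ u x) (j : Fin d) :
    partialD j (fun y => M (u y)) x = M (partialD j u x) := by
  have h := (M.restrictScalars ℝ).hasFDerivAt.comp x hu.hasFDerivAt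
  have h2 : fderiv ℝ (fun y => M (u y)) x = _ := h.fderiv
  simp only [partialD, h2]
  rfl

theorem partialD_mul {d : ℕ} {u v : RSpace d → ℝ} {x : RSpace d}
    (hu : DifferentiableAt ℝ u x) (hv : DifferentiableAt ℝ v x) (j : Fin d) :
    partialD j (fun y => u y * v y) x = partialD j u x * v x + u x * partialD j v x := by
  simp only [partialD, fderiv_fun_mul hu hv]
  simp
  ring

theorem contDiff_re_inner {d : ℕ} {n : WithTop ℕ∞} {u v : RSpace d → Spinor d} (hu : ContDiff ℝ n u)
    (hv : ContDiff ℝ n v) : ContDiff ℝ n (fun y => (inner ℂ (u y) (v y)).re) :=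
  Complex.reCLM.contDiff.comp (hu.inner ℂ hv)

theorem contDiff_clm_comp {d : ℕ} {n : WithTop ℕ∞} (M : Spinor d →L[ℂ] Spinor d)
    {u : RSpace d → Spinor d} (hu : ContDiff ℝ n u) : ContDiff ℝ n (fun y => M (u y)) :=
  (M.restrictScalars ℝ).contDiff.comp hu

/-- For a skew form `ω(u, v) = Re⟨S u, v⟩`, the current
`∂_k (η ω(∂_j φ, φ)) - ∂_j (η ω(∂_k φ, φ))` has no second derivatives of `φ`. -/
theorem integral_skew_current {d : ℕ} {φ : RSpace d → Spinor d} (hφ : IsTestFunction φ)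
    (S : Spinor d →L[ℂ] Spinor d)
    (hS : ∀ u v, (inner ℂ (S u) v).re = -(inner ℂ (S v) u).re)
    {η : RSpace d → ℝ} (hη : ContDiff ℝ 1 η) (j k : Fin d) :
    Integrable (fun x => partialD k η x * (inner ℂ (S (partialD j φ x)) (φ x)).re
      + 2 * (η x * (inner ℂ (S (partialD j φ x)) (partialD k φ x)).re)
      - partialD j η x * (inner ℂ (S (partialD k φ x)) (φ x)).re) ∧
    ∫ x, (partialD k η x * (inner ℂ (S (partialD j φ x)) (φ x)).re
      + 2 * (η x * (inner ℂ (S (partialD j φ x)) (partialD k φ x)).re)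
      - partialD j η x * (inner ℂ (S (partialD k φ x)) (φ x)).re) = 0 := by
  have hr : ∀ l, ContDiff ℝ 1 (fun x => (inner ℂ (S (partialD l φ x)) (φ x)).re) := fun l =>
    contDiff_re_inner (contDiff_clm_comp S ((hφ.partialD l).1.of_le (by simp)))
      (hφ.1.of_le (by simp))
  have hc : ∀ l, ContDiff ℝ 1 (fun x => η x * (inner ℂ (S (partialD l φ x)) (φ x)).re) :=
    fun l => hη.mul (hr l)
  have hs : ∀ l, HasCompactSupport (fun x => η x * (inner ℂ (S (partialD l φ x)) (φ x)).re) := by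
    intro l
    refine hφ.2.mono ?_
    intro x hx
    rw [Function.mem_support] at hx ⊢
    intro h
    simp [h] at hx
  have e : ∀ l i x, partialD i (fun x => η x * (inner ℂ (S (partialD l φ x)) (φ x)).re) x =
      partialD i η x * (inner ℂ (S (partialD l φ x)) (φ x)).re
      + η x * ((inner ℂ (S (partialD i (partialD l φ) x)) (φ x)).re
        + (inner ℂ (S (partialD l φ x)) (partialD i φ x)).re) := by
    intro l i x
    rw [partialD_mul (hη.differentiable (by simp) x) ((hr l).differentiable (by simp) x),
      partialD_re_inner ((contDiff_clm_comp S (hφ.partialD l).1).differentiable (by simp) x)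
        (hφ.differentiable x), partialD_clm_comp S ((hφ.partialD l).differentiable x)]
  have key : (fun x => partialD k η x * (inner ℂ (S (partialD j φ x)) (φ x)).re
      + 2 * (η x * (inner ℂ (S (partialD j φ x)) (partialD k φ x)).re)
      - partialD j η x * (inner ℂ (S (partialD k φ x)) (φ x)).re) =
      fun x => partialD k (fun x => η x * (inner ℂ (S (partialD j φ x)) (φ x)).re) x
        - partialD j (fun x => η x * (inner ℂ (S (partialD k φ x)) (φ x)).re) x := by
    funext x
    -- The mixed second derivatives cancel by symmetry, and the two products of first derivatives
    -- add up by skewness, hence the factor 2.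
    rw [e, e, hφ.partialD_comm k j, hS (partialD k φ x) (partialD j φ x)]
    ring
  have i := fun l i => integrable_partialD (hc l) (hs l) i
  rw [key]
  refine ⟨(i j k).sub (i k j), ?_⟩
  rw [integral_sub (i j k) (i k j), integral_partialD_eq_zero (hc j) (hs j),
    integral_partialD_eq_zero (hc k) (hs k), sub_zero]

/-- The integrands differ by the divergence `∂_j⟨φ, M ∂_k φ⟩ - ∂_k⟨φ, M ∂_j φ⟩`, in which the second
derivatives cancel. -/
theorem integral_partialD_swap {d : ℕ} {φ : RSpace d → Spinor d} (hφ : IsTestFunction φ)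
    (M : Spinor d →L[ℂ] Spinor d) (j k : Fin d) :
    ∫ x, (inner ℂ (partialD j φ x) (M (partialD k φ x))).re =
      ∫ x, (inner ℂ (partialD k φ x) (M (partialD j φ x))).re := by
  have hc : ∀ l, ContDiff ℝ 1 (fun x => (inner ℂ (φ x) (M (partialD l φ x))).re) := fun l =>
    contDiff_re_inner (hφ.1.of_le (by simp)) (contDiff_clm_comp M ((hφ.partialD l).1.of_le (by simp)))
  have hs : ∀ l, HasCompactSupport (fun x => (inner ℂ (φ x) (M (partialD l φ x))).re) := by
    intro l
    refine hφ.2.mono' ?_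
    intro x hx
    apply subset_tsupport
    rw [Function.mem_support] at hx ⊢
    intro h
    simp [h] at hx
  have hi := fun l i => integrable_partialD (hc l) (hs l) i
  have e : ∀ l i x, partialD i (fun x => (inner ℂ (φ x) (M (partialD l φ x))).re) x =
      (inner ℂ (partialD i φ x) (M (partialD l φ x))).re
        + (inner ℂ (φ x) (M (partialD i (partialD l φ) x))).re := by
    intro l i x
    rw [partialD_re_inner (hφ.differentiable x)
      ((contDiff_clm_comp M (hφ.partialD l).1).differentiable (by simp) x),
      partialD_clm_comp M ((hφ.partialD l).differentiable x)]
  have hj : ∀ l i, Integrable (fun x => (inner ℂ (partialD i φ x) (M (partialD l φ x))).re) := by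
    intro l i
    refine ((contDiff_re_inner (hφ.partialD i).1 (contDiff_clm_comp M
      (hφ.partialD l).1)).continuous).integrable_of_hasCompactSupport
      ((hφ.partialD i).2.mono' ?_)
    intro x hx
    apply subset_tsupport
    rw [Function.mem_support] at hx ⊢
    intro h
    simp [h] at hx
  rw [← sub_eq_zero, ← integral_sub (hj k j) (hj j k)]
  refine Eq.trans ?_ (show (∫ x, partialD j (fun x => (inner ℂ (φ x) (M (partialD k φ x))).re) x)
    - ∫ x, partialD k (fun x => (inner ℂ (φ x) (M (partialD j φ x))).re) x = 0 by
      rw [integral_partialD_eq_zero (hc k) (hs k) j, integral_partialD_eq_zero (hc j) (hs j) k,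
        sub_zero])
  rw [← integral_sub (hi k j) (hi j k)]
  congr 1
  funext x
  rw [e, e, hφ.partialD_comm k j]
  ring

theorem integrable_re_inner_clm {d : ℕ} {φ χ : RSpace d → Spinor d} (hφ : IsTestFunction φ)
    (hχ : IsTestFunction χ) (M N : Spinor d →L[ℂ] Spinor d) :
    Integrable (fun x => (inner ℂ (M (φ x)) (N (χ x))).re) := by
  refine (contDiff_re_inner (contDiff_clm_comp M hφ.1) (contDiff_clm_comp N
    hχ.1)).continuous.integrable_of_hasCompactSupport (hφ.2.mono' ?_)
  intro x hx
  apply subset_tsupport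
  rw [Function.mem_support] at hx ⊢
  intro h
  simp [h] at hx

/-- The kinetic part of the Dirac operator has the same `L²` norm as the gradient. -/
theorem integral_norm_sq_sum_clifford {d : ℕ} {φ : RSpace d → Spinor d} (hφ : IsTestFunction φ)
    (a : Fin d → Spinor d →L[ℂ] Spinor d)
    (ha : ∀ j u v, inner ℂ (a j u) v = inner ℂ u (a j v))
    (hc : ∀ j k u, a j (a k u) + a k (a j u) = if j = k then (2 : ℂ) • u else 0) :
    ∫ x, ‖∑ j, a j (partialD j φ x)‖ ^ 2 = ∑ j, ∫ x, ‖partialD j φ x‖ ^ 2 := by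
  set q : Fin d → Fin d → ℝ := fun j k =>
    ∫ x, (inner ℂ (a j (partialD j φ x)) (a k (partialD k φ x))).re with hq
  have h1 : ∫ x, ‖∑ j, a j (partialD j φ x)‖ ^ 2 = ∑ j, ∑ k, q j k := by
    simp only [hq]
    simp_rw [← integral_finsetSum Finset.univ (fun k _ => integrable_re_inner_clm
      (hφ.partialD _) (hφ.partialD k) (a _) (a k))]
    rw [← integral_finsetSum Finset.univ (fun j _ => integrable_finsetSum _
      fun k _ => integrable_re_inner_clm (hφ.partialD _) (hφ.partialD k) (a _) (a k))]
    congr 1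
    funext x
    rw [← inner_self_eq_norm_sq (𝕜 := ℂ), sum_inner]
    simp_rw [inner_sum]
    simp
  have h2 : ∀ j k, q j k + q k j = if j = k then 2 * ∫ x, ‖partialD j φ x‖ ^ 2 else 0 := by
    intro j k
    have e1 : q j k = ∫ x, (inner ℂ (partialD j φ x) ((a j ∘L a k) (partialD k φ x))).re := by
      simp only [hq, ha]; rfl
    -- Swapping the derivatives brings `q k j` to the same pair `∂_j φ`, `∂_k φ` as `q j k`, so that
    -- only the anticommutator of `a j` and `a k` survives in the sum.
    have e2 : q k j = ∫ x, (inner ℂ (partialD j φ x) ((a k ∘L a j) (partialD k φ x))).re := by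
      rw [← integral_partialD_swap hφ]
      simp only [hq, ha]; rfl
    have i := fun M => integrable_re_inner_clm (hφ.partialD j) (hφ.partialD k) (.id ℂ _) M
    simp only [ContinuousLinearMap.id_apply] at i
    rw [e1, e2, ← integral_add (i _) (i _)]
    simp_rw [← Complex.add_re, ← inner_add_right, ContinuousLinearMap.comp_apply, hc]
    split_ifs with h
    · subst h
      rw [← integral_const_mul]
      congr 1
      funext x
      rw [inner_smul_right, ← inner_self_eq_norm_sq (𝕜 := ℂ)]
      simp [-inner_self_eq_norm_sq_to_K]
    · simp
  have h3 : 2 * ∑ j, ∑ k, q j k = ∑ j, ∑ k, (q j k + q k j) := by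
    simp_rw [Finset.sum_add_distrib]
    rw [Finset.sum_comm (f := fun j k => q k j)]
    ring
  rw [h1]
  have : 2 * ∑ j, ∑ k, q j k = 2 * ∑ j, ∫ x, ‖partialD j φ x‖ ^ 2 := by
    rw [h3]; simp_rw [h2]; simp [Finset.mul_sum]
  linarith

/-! ### The virial identity with a cutoff -/

theorem ContDiffAt.clm_complex_apply {d : ℕ} {n : WithTop ℕ∞}
    {M : RSpace d → Spinor d →L[ℂ] Spinor d} {u : RSpace d → Spinor d} {x : RSpace d}
    (hM : ContDiffAt ℝ n M x) (hu : ContDiffAt ℝ n u x) :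
    ContDiffAt ℝ n (fun y => M y (u y)) x :=
  ((ContinuousLinearMap.restrictScalarsL ℂ (Spinor d) (Spinor d) ℝ ℝ).contDiff.contDiffAt.comp x
    hM).clm_apply hu

theorem partialD_clm_apply {d : ℕ} {M : RSpace d → Spinor d →L[ℂ] Spinor d}
    {u : RSpace d → Spinor d} {x : RSpace d} (hM : DifferentiableAt ℝ M x)
    (hu : DifferentiableAt ℝ u x) (j : Fin d) :
    partialD j (fun y => M y (u y)) x = partialD j M x (u x) + M x (partialD j u x) := by
  have h := ((ContinuousLinearMap.restrictScalarsL ℂ (Spinor d) (Spinor d) ℝ ℝ).hasFDerivAt.comp x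
    hM.hasFDerivAt).clm_apply hu.hasFDerivAt
  have h2 : fderiv ℝ (fun y => M y (u y)) x = _ := h.fderiv
  simp only [partialD, h2]
  simp
  rw [add_comm]

/-- The divergence of `η ⟨M φ, φ⟩ e_k`, for a Hermitian `M` that is smooth off the origin. -/
theorem integral_hermitian_current {d : ℕ} {φ : RSpace d → Spinor d} (hφ : IsTestFunction φ)
    {M : RSpace d → Spinor d →L[ℂ] Spinor d} (hM : ∀ x, x ≠ 0 → ContDiffAt ℝ 1 M x)
    (hsym : ∀ x, x ≠ 0 → ∀ u v, inner ℂ (M x u) v = inner ℂ u (M x v))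
    {η : RSpace d → ℝ} (hη : ContDiff ℝ 1 η) (h0 : ∀ᶠ x in nhds 0, η x = 0) (k : Fin d) :
    Integrable (fun x => partialD k η x * (inner ℂ (M x (φ x)) (φ x)).re
      + η x * ((inner ℂ (partialD k M x (φ x)) (φ x)).re
        + 2 * (inner ℂ (M x (φ x)) (partialD k φ x)).re)) ∧
    ∫ x, (partialD k η x * (inner ℂ (M x (φ x)) (φ x)).re
      + η x * ((inner ℂ (partialD k M x (φ x)) (φ x)).re
        + 2 * (inner ℂ (M x (φ x)) (partialD k φ x)).re)) = 0 := by
  have hMφ : ∀ x, x ≠ 0 → ContDiffAt ℝ 1 (fun y => M y (φ y)) x := fun x hx =>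
    (hM x hx).clm_complex_apply (hφ.1.of_le (by simp)).contDiffAt
  have hr : ∀ x, x ≠ 0 → ContDiffAt ℝ 1 (fun x => (inner ℂ (M x (φ x)) (φ x)).re) x := fun x hx =>
    Complex.reCLM.contDiff.contDiffAt.comp x
      ((hMφ x hx).inner ℂ (hφ.1.of_le (by simp)).contDiffAt)
  have hc : ContDiff ℝ 1 (fun x => η x * (inner ℂ (M x (φ x)) (φ x)).re) := by
    rw [contDiff_iff_contDiffAt]
    intro x
    -- `M` may be singular at the origin, but the product vanishes identically near it because `η`
    -- does.
    by_cases hx : x = 0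
    · subst hx
      refine (contDiffAt_const (c := (0 : ℝ))).congr_of_eventuallyEq ?_
      filter_upwards [h0] with y hy
      simp [hy]
    · exact hη.contDiffAt.mul (hr x hx)
  have hs : HasCompactSupport (fun x => η x * (inner ℂ (M x (φ x)) (φ x)).re) := by
    refine hφ.2.mono ?_
    intro x hx
    rw [Function.mem_support] at hx ⊢
    intro h
    simp [h] at hx
  have key : (fun x => partialD k η x * (inner ℂ (M x (φ x)) (φ x)).re
      + η x * ((inner ℂ (partialD k M x (φ x)) (φ x)).re
        + 2 * (inner ℂ (M x (φ x)) (partialD k φ x)).re)) =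
      partialD k (fun x => η x * (inner ℂ (M x (φ x)) (φ x)).re) := by
    funext x
    by_cases hx : x = 0
    · subst hx
      have e1 : partialD k η 0 = 0 := by
        have : η =ᶠ[nhds 0] fun _ => (0 : ℝ) := h0
        simp [partialD, this.fderiv_eq]
      have e2 : partialD k (fun x => η x * (inner ℂ (M x (φ x)) (φ x)).re) 0 = 0 := by
        have : (fun x => η x * (inner ℂ (M x (φ x)) (φ x)).re) =ᶠ[nhds 0] fun _ => (0 : ℝ) := by
          filter_upwards [h0] with y hy
          simp [hy]
        simp [partialD, this.fderiv_eq]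
      rw [e1, e2, h0.self_of_nhds]
      simp
    · rw [partialD_mul (hη.differentiable (by simp) x) ((hr x hx).differentiableAt (by simp)),
        partialD_re_inner ((hMφ x hx).differentiableAt (by simp)) (hφ.differentiable x),
        partialD_clm_apply ((hM x hx).differentiableAt (by simp)) (hφ.differentiable x),
        inner_add_left, hsym x hx (partialD k φ x), Complex.add_re]
      rw [← inner_conj_symm (partialD k φ x), Complex.conj_re]
      ring
  rw [key]
  exact ⟨integrable_partialD hc hs k, integral_partialD_eq_zero hc hs k⟩

theorem partialD_coord {d : ℕ} (j k : Fin d) (x : RSpace d) :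
    partialD j (fun y : RSpace d => y k) x = if j = k then 1 else 0 := by
  have h : fderiv ℝ (fun y : RSpace d => y k) x = EuclideanSpace.proj k :=
    (EuclideanSpace.proj (𝕜 := ℝ) k).hasFDerivAt.fderiv
  simp [partialD, h, eq_comm]

theorem contDiff_coord {d : ℕ} {n : WithTop ℕ∞} (k : Fin d) :
    ContDiff ℝ n (fun y : RSpace d => y k) :=
  (EuclideanSpace.proj (𝕜 := ℝ) k).contDiff

theorem partialD_radial {d : ℕ} {h : ℝ → ℝ} {h' : ℝ} {x : RSpace d}
    (hh : HasDerivAt h h' (‖x‖ ^ 2)) (k : Fin d) :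
    partialD k (fun y => h (‖y‖ ^ 2)) x = h' * (2 * x k) := by
  have e := hh.comp_hasFDerivAt x (hasStrictFDerivAt_norm_sq x).hasFDerivAt
  have h2 : fderiv ℝ (fun y : RSpace d => h (‖y‖ ^ 2)) x = _ := e.fderiv
  simp only [partialD, h2]
  simp [EuclideanSpace.inner_single_right]

/-- The pointwise algebra of the virial identity. Here `G = g`, `p = ∇g`, `m = Re⟨Mφ, φ⟩`, `c k =
Re⟨Mφ, ∂_k φ⟩`, `b k = Re⟨(∂_k M)φ, φ⟩`, `A j k = Re⟨s_j ∂_j φ, ∂_k φ⟩` and `a j k = Re⟨s_j ∂_k φ,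
φ⟩`. The right side is a sum of divergences of currents with weights `g x_k`. -/
theorem virial_sum_identity {d : ℕ} (G m : ℝ) (x p c b : Fin d → ℝ) (A a : Fin d → Fin d → ℝ) :
    2 * (∑ k, G * x k * (∑ i, A i k + c k)
        + (d * G + ∑ k, x k * p k) / 2 * (∑ i, a i i + m))
      - G * ∑ i, a i i - ∑ j, ∑ k, p j * x k * a j k + G * ∑ k, x k * b k =
    ∑ j, ∑ k, ((p k * x k + G * 1) * a j j + 2 * (G * x k * A j k)
        - (p j * x k + G * if j = k then 1 else 0) * a j k)
      + ∑ k, ((p k * x k + G * 1) * m + G * x k * (b k + 2 * c k)) := by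
  have e1 : ∑ j, ∑ k, (p k * x k + G * 1) * a j j =
      (d * G + ∑ k, x k * p k) * ∑ i, a i i := by
    simp_rw [← Finset.sum_mul, ← Finset.mul_sum, Finset.sum_add_distrib]
    simp [mul_comm, add_comm]
  have e2 : ∑ j, ∑ k, 2 * (G * x k * A j k) = 2 * ∑ k, G * x k * ∑ i, A i k := by
    rw [Finset.sum_comm]
    simp_rw [Finset.mul_sum]
  have e3 : ∑ j, ∑ k, (p j * x k + G * if j = k then 1 else 0) * a j k =
      ∑ j, ∑ k, p j * x k * a j k + G * ∑ i, a i i := by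
    simp_rw [add_mul, Finset.sum_add_distrib]
    simp [Finset.mul_sum]
  have e4 : ∑ k, ((p k * x k + G * 1) * m + G * x k * (b k + 2 * c k)) =
      (d * G + ∑ k, x k * p k) * m + G * ∑ k, x k * b k + 2 * ∑ k, G * x k * c k := by
    simp_rw [mul_add, Finset.sum_add_distrib, ← Finset.sum_mul, Finset.sum_add_distrib,
      Finset.mul_sum]
    simp [mul_comm, mul_assoc, mul_left_comm, add_comm]
    ring
  simp_rw [Finset.sum_sub_distrib, Finset.sum_add_distrib]
  simp_rw [Finset.sum_add_distrib] at e4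
  rw [e1, e2, e3, e4]
  simp_rw [mul_add (G * x _), Finset.sum_add_distrib]
  ring

/-- The virial identity with a cutoff `g` vanishing near the origin, for the multiplier
`g x·∇ + ½ div(g x)` and the operator `∑ s_j ∂_j + M`, where the `s_j` are skew. -/
theorem integral_virial_cutoff {d : ℕ} {φ : RSpace d → Spinor d} (hφ : IsTestFunction φ)
    (s : Fin d → Spinor d →L[ℂ] Spinor d)
    (hs : ∀ j u v, (inner ℂ (s j u) v).re = -(inner ℂ (s j v) u).re)
    {M : RSpace d → Spinor d →L[ℂ] Spinor d} (hM : ∀ x, x ≠ 0 → ContDiffAt ℝ 1 M x)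
    (hsym : ∀ x, x ≠ 0 → ∀ u v, inner ℂ (M x u) v = inner ℂ u (M x v))
    {g : RSpace d → ℝ} (hg : ContDiff ℝ 1 g) (h0 : ∀ᶠ x in nhds 0, g x = 0) :
    ∫ x, (2 * (inner ℂ (∑ j, s j (partialD j φ x) + M x (φ x))
        (∑ k, (g x * x k) • partialD k φ x
          + ((d * g x + ∑ k, x k * partialD k g x) / 2) • φ x)).re
      - g x * (inner ℂ (∑ j, s j (partialD j φ x)) (φ x)).re
      - ∑ j, ∑ k, partialD j g x * x k * (inner ℂ (s j (partialD k φ x)) (φ x)).re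
      + g x * (inner ℂ (∑ k, x k • partialD k M x (φ x)) (φ x)).re) = 0 := by
  have hη : ∀ k : Fin d, ContDiff ℝ 1 (fun x => g x * x k) := fun k => hg.mul (contDiff_coord k)
  have h0η : ∀ k : Fin d, ∀ᶠ x in nhds (0 : RSpace d), g x * x k = 0 := fun k => by
    filter_upwards [h0] with x hx
    simp [hx]
  -- With the weights `g x_k`, the skew currents account for the first-order part and the Hermitian
  -- currents for `M`; every one of them integrates to zero.
  have hA := fun j k => integral_skew_current hφ (s j) (hs j) (hη k) j k
  have hB := fun k => integral_hermitian_current hφ hM hsym (hη k) (h0η k) k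
  have h1 := integral_add (integrable_finsetSum Finset.univ fun j _ =>
    integrable_finsetSum Finset.univ fun k _ => (hA j k).1)
    (integrable_finsetSum Finset.univ fun k _ => (hB k).1)
  rw [integral_finsetSum _ (fun j _ => integrable_finsetSum Finset.univ fun k _ => (hA j k).1),
    integral_finsetSum _ (fun k _ => (hB k).1)] at h1
  simp_rw [integral_finsetSum Finset.univ (fun k _ => (hA _ k).1), (hA _ _).2, (hB _).2] at h1
  simp only [Finset.sum_const_zero, add_zero] at h1
  rw [← h1]
  congr 1
  funext x
  have e : ∀ j k : Fin d, partialD j (fun x => g x * x k) x =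
      partialD j g x * x k + g x * (if j = k then 1 else 0) := by
    intro j k
    rw [partialD_mul (hg.differentiable (by simp) x)
      ((contDiff_coord (n := 1) k).differentiable (by simp) x), partialD_coord]
  simp_rw [e]
  simp only [inner_add_left, inner_add_right, sum_inner, inner_sum, Complex.add_re,
    Complex.re_sum, ← Complex.coe_smul, inner_smul_left, inner_smul_right, Complex.conj_ofReal,
    Complex.re_ofReal_mul]
  simp only [if_true]
  exact virial_sum_identity (g x) _ (fun k => x k) (fun k => partialD k g x) _ _
    (fun j k => (inner ℂ (s j (partialD j φ x)) (partialD k φ x)).re)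
    (fun j k => (inner ℂ (s j (partialD k φ x)) (φ x)).re)

/-! ### Calculus of `L²` norms -/

/-- The `L²` norm of a function on `ℝ^d`. -/
noncomputable def l2norm {d : ℕ} {F : Type*} [NormedAddCommGroup F] (f : RSpace d → F) : ℝ :=
  (eLpNorm f 2 volume).toReal

section L2

variable {d : ℕ} {F : Type*} [NormedAddCommGroup F]

theorem l2norm_nonneg (f : RSpace d → F) : 0 ≤ l2norm f := ENNReal.toReal_nonneg

theorem l2norm_eq_norm_toLp {f : RSpace d → F} (hf : MemLp f 2 volume) :
    l2norm f = ‖hf.toLp f‖ := (Lp.norm_toLp f hf).symm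

theorem l2norm_add_le {f g : RSpace d → F} (hf : MemLp f 2 volume) (hg : MemLp g 2 volume) :
    l2norm (fun x => f x + g x) ≤ l2norm f + l2norm g := by
  rw [l2norm_eq_norm_toLp hf, l2norm_eq_norm_toLp hg, show l2norm (fun x => f x + g x) = _ from l2norm_eq_norm_toLp (hf.add hg), MemLp.toLp_add]
  exact norm_add_le _ _

theorem l2norm_sub_le {f g : RSpace d → F} (hf : MemLp f 2 volume) (hg : MemLp g 2 volume) :
    l2norm (fun x => f x - g x) ≤ l2norm f + l2norm g := by
  rw [l2norm_eq_norm_toLp hf, l2norm_eq_norm_toLp hg, show l2norm (fun x => f x - g x) = _ from l2norm_eq_norm_toLp (hf.sub hg), MemLp.toLp_sub]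
  exact norm_sub_le _ _

theorem l2norm_le_mul_of_ae {G : Type*} [NormedAddCommGroup G] {f : RSpace d → F}
    {g : RSpace d → G} (hg : MemLp g 2 volume) {c : ℝ} (hc : 0 ≤ c)
    (h : ∀ᵐ x, ‖f x‖ ≤ c * ‖g x‖) : l2norm f ≤ c * l2norm g := by
  have h1 := eLpNorm_le_mul_eLpNorm_of_ae_le_mul h 2
  have h2 := ENNReal.toReal_mono (ENNReal.mul_ne_top ENNReal.ofReal_ne_top hg.2.ne) h1
  rwa [ENNReal.toReal_mul, ENNReal.toReal_ofReal hc] at h2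

theorem l2norm_sum_le {ι : Type*} (s : Finset ι) {f : ι → RSpace d → F}
    (hf : ∀ i, MemLp (f i) 2 volume) : l2norm (fun x => ∑ i ∈ s, f i x) ≤ ∑ i ∈ s, l2norm (f i) := by
  classical
  induction s using Finset.induction_on with
  | empty => simp [l2norm]
  | insert i s hi ih =>
    simp_rw [Finset.sum_insert hi]
    exact (l2norm_add_le (hf i) (memLp_finsetSum s fun i _ => hf i)).trans (by gcongr)

theorem l2norm_sq {f : RSpace d → F} (hf : MemLp f 2 volume) :
    l2norm f ^ 2 = ∫ x, ‖f x‖ ^ 2 := by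
  have h := hf.eLpNorm_eq_integral_rpow_norm (by simp) (by simp)
  have h0 : 0 ≤ ∫ x, ‖f x‖ ^ 2 := integral_nonneg fun x => by positivity
  rw [l2norm, h]
  simp only [ENNReal.toReal_ofNat, Real.rpow_ofNat]
  rw [ENNReal.toReal_ofReal (by positivity), ← Real.rpow_natCast, ← Real.rpow_mul h0]
  norm_num

theorem toLp_re_inner {f g : RSpace d → Spinor d} (hf : MemLp f 2 volume) (hg : MemLp g 2 volume) :
    (inner ℂ (hf.toLp f) (hg.toLp g)).re = ∫ x, (inner ℂ (f x) (g x)).re := by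
  rw [L2.inner_def]
  have h : Integrable (fun x => inner ℂ (hf.toLp f x) (hg.toLp g x)) := L2.integrable_inner _ _
  have h2 := integral_re h
  rw [← RCLike.re_eq_complex_re, ← h2]
  refine integral_congr_ae ?_
  filter_upwards [hf.coeFn_toLp, hg.coeFn_toLp] with x h1 h2
  rw [h1, h2]

theorem integrable_re_inner {f g : RSpace d → Spinor d} (hf : MemLp f 2 volume)
    (hg : MemLp g 2 volume) : Integrable (fun x => (inner ℂ (f x) (g x)).re) := by
  have h : Integrable (fun x => inner ℂ (hf.toLp f x) (hg.toLp g x)) := L2.integrable_inner _ _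
  refine (h.re).congr ?_
  filter_upwards [hf.coeFn_toLp, hg.coeFn_toLp] with x h1 h2
  rw [h1, h2]
  rfl

theorem abs_integral_re_inner_le {f g : RSpace d → Spinor d} (hf : MemLp f 2 volume)
    (hg : MemLp g 2 volume) : |∫ x, (inner ℂ (f x) (g x)).re| ≤ l2norm f * l2norm g := by
  rw [← toLp_re_inner hf hg, l2norm_eq_norm_toLp hf, l2norm_eq_norm_toLp hg]
  exact (Complex.abs_re_le_norm _).trans (norm_inner_le_norm _ _)

theorem IsTestFunction.memLp [NormedSpace ℝ F] {φ : RSpace d → F} (hφ : IsTestFunction φ) :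
    MemLp φ 2 volume := hφ.continuous.memLp_of_hasCompactSupport hφ.2

end L2

/-! ### Hardy's inequality -/

theorem re_inner_self_eq {d : ℕ} (u : Spinor d) : (inner ℂ u u).re = ‖u‖ ^ 2 := by
  have := inner_self_eq_norm_sq (𝕜 := ℂ) u
  simpa using this

theorem abs_re_inner_le {d : ℕ} (u v : Spinor d) : |(inner ℂ u v).re| ≤ ‖u‖ * ‖v‖ :=
  (Complex.abs_re_le_norm _).trans (norm_inner_le_norm _ _)

theorem norm_sq_eq_sum {d : ℕ} (x : RSpace d) : ‖x‖ ^ 2 = ∑ k, x k ^ 2 := by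
  rw [EuclideanSpace.norm_sq_eq]; simp

/-- The field `x |φ|² / (|x|² + ε)` has divergence of integral zero; `ε` keeps it smooth at the
origin. Young's inequality with weight `c = (d-2)/2` bounds the cross term, and `d - 2 - c = c`
leaves `c` times the left side, at most `c⁻¹ ‖∇φ‖²`. This choice of weight gives the constant `c⁻²`.
-/
theorem integral_hardy_regularized {d : ℕ} (hd : 3 ≤ d) {φ : RSpace d → Spinor d}
    (hφ : IsTestFunction φ) {ε : ℝ} (hε : 0 < ε) :
    ∫ x, ‖φ x‖ ^ 2 / (‖x‖ ^ 2 + ε) ≤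
      (2 / ((d : ℝ) - 2)) ^ 2 * ∑ j, ∫ x, ‖partialD j φ x‖ ^ 2 := by
  have hd' : (0 : ℝ) < (d : ℝ) - 2 := by
    have : (3 : ℝ) ≤ d := by exact_mod_cast hd
    linarith
  set c : ℝ := ((d : ℝ) - 2) / 2 with hc
  have hc0 : 0 < c := by positivity
  have hq : ∀ x : RSpace d, 0 < ‖x‖ ^ 2 + ε := fun x => by positivity
  have hinv : ContDiff ℝ 1 (fun x : RSpace d => (‖x‖ ^ 2 + ε)⁻¹) :=
    (((contDiff_norm_sq ℝ).add contDiff_const).inv fun x => (hq x).ne')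
  have hη : ∀ k : Fin d, ContDiff ℝ 1 (fun x : RSpace d => (‖x‖ ^ 2 + ε)⁻¹ * x k) := fun k =>
    hinv.mul (contDiff_coord k)
  have hr : ContDiff ℝ 1 (fun x => (inner ℂ (φ x) (φ x)).re) :=
    contDiff_re_inner (hφ.1.of_le (by simp)) (hφ.1.of_le (by simp))
  have hF : ∀ k : Fin d, ContDiff ℝ 1
      (fun x : RSpace d => (‖x‖ ^ 2 + ε)⁻¹ * x k * (inner ℂ (φ x) (φ x)).re) :=
    fun k => (hη k).mul hr
  have hs : ∀ k : Fin d, HasCompactSupport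
      (fun x : RSpace d => (‖x‖ ^ 2 + ε)⁻¹ * x k * (inner ℂ (φ x) (φ x)).re) := by
    intro k
    refine hφ.2.mono ?_
    intro x hx
    rw [Function.mem_support] at hx ⊢
    intro h
    simp [h] at hx
  have hi := fun k => integrable_partialD (hF k) (hs k) k
  have h0 := fun k => integral_partialD_eq_zero (hF k) (hs k) k
  have hN : ∀ j, Integrable (fun x => ‖partialD j φ x‖ ^ 2) := fun j => by
    have := (hφ.partialD j).memLp.norm.integrable_sq
    exact this
  have hH : Integrable (fun x => ‖φ x‖ ^ 2 / (‖x‖ ^ 2 + ε)) := by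
    refine Continuous.integrable_of_hasCompactSupport ?_ ?_
    · exact (hφ.continuous.norm.pow 2).div (by fun_prop) fun x => (hq x).ne'
    · refine hφ.2.mono ?_
      intro x hx
      rw [Function.mem_support] at hx ⊢
      intro h
      simp [h] at hx
  have hpt : ∀ x, c * (‖φ x‖ ^ 2 / (‖x‖ ^ 2 + ε)) - c⁻¹ * ∑ j, ‖partialD j φ x‖ ^ 2 ≤
      ∑ k, partialD k (fun x : RSpace d => (‖x‖ ^ 2 + ε)⁻¹ * x k * (inner ℂ (φ x) (φ x)).re) x := by
    intro x
    have hdiv : ∀ k, partialD k (fun x : RSpace d => (‖x‖ ^ 2 + ε)⁻¹) x =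
        -(((‖x‖ ^ 2 + ε) ^ 2)⁻¹) * (2 * x k) := by
      intro k
      refine partialD_radial (h := fun s => (s + ε)⁻¹) ?_ k
      have := ((hasDerivAt_id (‖x‖ ^ 2)).add_const ε).inv (hq x).ne'
      simp only [id, neg_div, one_div] at this
      exact this
    have e : ∀ k, partialD k
        (fun x : RSpace d => (‖x‖ ^ 2 + ε)⁻¹ * x k * (inner ℂ (φ x) (φ x)).re) x =
        (-(((‖x‖ ^ 2 + ε) ^ 2)⁻¹) * (2 * x k ^ 2) + (‖x‖ ^ 2 + ε)⁻¹) * ‖φ x‖ ^ 2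
          + 2 * ((‖x‖ ^ 2 + ε)⁻¹ * x k * (inner ℂ (partialD k φ x) (φ x)).re) := by
      intro k
      rw [partialD_mul ((hη k).differentiable (by simp) x) (hr.differentiable (by simp) x),
        partialD_mul (hinv.differentiable (by simp) x)
          ((contDiff_coord (n := 1) k).differentiable (by simp) x), hdiv, partialD_coord,
        partialD_re_inner (hφ.differentiable x) (hφ.differentiable x), re_inner_self_eq,
        ← inner_conj_symm (φ x) (partialD k φ x), Complex.conj_re]
      simp
      ring
    have hle : ∀ k, -(c * (((‖x‖ ^ 2 + ε) ^ 2)⁻¹ * x k ^ 2 * ‖φ x‖ ^ 2)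
        + c⁻¹ * ‖partialD k φ x‖ ^ 2) ≤
        2 * ((‖x‖ ^ 2 + ε)⁻¹ * x k * (inner ℂ (partialD k φ x) (φ x)).re) := by
      intro k
      set A := (‖x‖ ^ 2 + ε)⁻¹ * x k * ‖φ x‖ with hA
      have h1 := abs_re_inner_le (partialD k φ x) (φ x)
      have h2 : |(‖x‖ ^ 2 + ε)⁻¹ * x k * (inner ℂ (partialD k φ x) (φ x)).re| ≤
          |A| * ‖partialD k φ x‖ := by
        rw [hA, abs_mul _ ‖φ x‖, abs_norm, abs_mul _ (inner ℂ (partialD k φ x) (φ x)).re, mul_assoc]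
        rw [mul_comm ‖φ x‖]
        gcongr
      have h3 : c * (((‖x‖ ^ 2 + ε) ^ 2)⁻¹ * x k ^ 2 * ‖φ x‖ ^ 2) = c * |A| ^ 2 := by
        rw [sq_abs, hA, ← inv_pow]; ring
      have h4 : 2 * (|A| * ‖partialD k φ x‖) ≤ c * |A| ^ 2 + c⁻¹ * ‖partialD k φ x‖ ^ 2 := by
        have : 0 ≤ c⁻¹ * (c * |A| - ‖partialD k φ x‖) ^ 2 := by positivity
        have e : c⁻¹ * (c * |A| - ‖partialD k φ x‖) ^ 2 =
          c * |A| ^ 2 + c⁻¹ * ‖partialD k φ x‖ ^ 2 - 2 * (|A| * ‖partialD k φ x‖) := by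
          field_simp
          ring
        linarith
      rw [h3]
      have := neg_abs_le ((‖x‖ ^ 2 + ε)⁻¹ * x k * (inner ℂ (partialD k φ x) (φ x)).re)
      linarith
    have hsum := Finset.sum_le_sum fun k (_ : k ∈ Finset.univ) => hle k
    simp_rw [e, Finset.sum_add_distrib]
    refine le_trans ?_ (add_le_add le_rfl hsum)
    simp_rw [Finset.sum_neg_distrib, Finset.sum_add_distrib, ← Finset.mul_sum, ← Finset.sum_mul,
      Finset.sum_add_distrib, ← Finset.mul_sum, ← norm_sq_eq_sum]
    simp only [Finset.sum_const, Finset.card_univ, Fintype.card_fin, nsmul_eq_mul]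
    have hx := hq x
    have key : c * (‖φ x‖ ^ 2 / (‖x‖ ^ 2 + ε)) ≤
        (-(((‖x‖ ^ 2 + ε) ^ 2)⁻¹) * (2 * ‖x‖ ^ 2) + d * (‖x‖ ^ 2 + ε)⁻¹) * ‖φ x‖ ^ 2
          - c * (((‖x‖ ^ 2 + ε) ^ 2)⁻¹ * ‖x‖ ^ 2 * ‖φ x‖ ^ 2) := by
      -- The defect from the homogeneous case is exactly a nonnegative multiple of `ε`, so
      -- regularising costs nothing.
      have e : (-(((‖x‖ ^ 2 + ε) ^ 2)⁻¹) * (2 * ‖x‖ ^ 2) + d * (‖x‖ ^ 2 + ε)⁻¹) * ‖φ x‖ ^ 2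
          - c * (((‖x‖ ^ 2 + ε) ^ 2)⁻¹ * ‖x‖ ^ 2 * ‖φ x‖ ^ 2) - c * (‖φ x‖ ^ 2 / (‖x‖ ^ 2 + ε)) =
          ((c + 2) * ε) * ((‖x‖ ^ 2 + ε) ^ 2)⁻¹ * ‖φ x‖ ^ 2 := by
        have : (d : ℝ) = 2 * c + 2 := by rw [hc]; ring
        rw [this]
        field_simp
        ring
      have : 0 ≤ ((c + 2) * ε) * ((‖x‖ ^ 2 + ε) ^ 2)⁻¹ * ‖φ x‖ ^ 2 := by positivity
      linarith
    linarith
  have h1 := integral_mono ((hH.const_mul c).sub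
    ((integrable_finsetSum Finset.univ fun j _ => hN j).const_mul c⁻¹))
    (integrable_finsetSum Finset.univ fun k _ => hi k) hpt
  rw [integral_finsetSum _ (fun k _ => hi k)] at h1
  simp_rw [h0] at h1
  simp only [Pi.sub_apply] at h1
  rw [integral_sub (hH.const_mul c)
    ((integrable_finsetSum Finset.univ fun j _ => hN j).const_mul c⁻¹), integral_const_mul,
    integral_const_mul, integral_finsetSum _ (fun j _ => hN j)] at h1
  simp only [Finset.sum_const_zero] at h1
  have e : 2 / ((d : ℝ) - 2) = c⁻¹ := by rw [hc]; field_simp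
  rw [e]
  have h2 : c * ∫ x, ‖φ x‖ ^ 2 / (‖x‖ ^ 2 + ε) ≤ c⁻¹ * ∑ j, ∫ x, ‖partialD j φ x‖ ^ 2 := by linarith
  have h3 := mul_le_mul_of_nonneg_left h2 (inv_nonneg.2 hc0.le)
  rw [← mul_assoc, inv_mul_cancel₀ hc0.ne', one_mul] at h3
  linarith [h3, sq c⁻¹, mul_assoc c⁻¹ c⁻¹ (∑ j, ∫ x, ‖partialD j φ x‖ ^ 2)]

/-- Hardy's inequality for test functions. -/
theorem hardy {d : ℕ} (hd : 3 ≤ d) {φ : RSpace d → Spinor d} (hφ : IsTestFunction φ) {N : ℝ}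
    (hN0 : 0 ≤ N) (hN : N ^ 2 = ∑ j, ∫ x, ‖partialD j φ x‖ ^ 2) :
    MemLp (fun x => ‖x‖⁻¹ • φ x) 2 volume ∧
      l2norm (fun x => ‖x‖⁻¹ • φ x) ≤ 2 / ((d : ℝ) - 2) * N := by
  have hd' : (0 : ℝ) < (d : ℝ) - 2 := by
    have : (3 : ℝ) ≤ d := by exact_mod_cast hd
    linarith
  have : Nonempty (Fin d) := ⟨⟨0, by omega⟩⟩
  set f : ℕ → RSpace d → Spinor d := fun n x => (√(‖x‖ ^ 2 + 1 / ((n : ℝ) + 1)))⁻¹ • φ x with hf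
  have hpos : ∀ (n : ℕ) (x : RSpace d), 0 < ‖x‖ ^ 2 + 1 / ((n : ℝ) + 1) := fun n x => by positivity
  have hcont : ∀ n, Continuous (f n) := fun n =>
    (((by fun_prop : Continuous fun x : RSpace d => √(‖x‖ ^ 2 + 1 / ((n : ℝ) + 1)))).inv₀
      fun x => (Real.sqrt_pos.2 (hpos n x)).ne').smul hφ.continuous
  have hmem : ∀ n, MemLp (f n) 2 volume := by
    refine fun n => (hcont n).memLp_of_hasCompactSupport (hφ.2.mono ?_)
    intro x hx
    rw [Function.mem_support] at hx ⊢
    intro h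
    simp [hf, h] at hx
  have hle : ∀ n, l2norm (f n) ≤ 2 / ((d : ℝ) - 2) * N := by
    intro n
    have h := integral_hardy_regularized hd hφ (ε := 1 / ((n : ℝ) + 1)) (by positivity)
    rw [← hN, ← mul_pow] at h
    refine (sq_le_sq₀ (l2norm_nonneg _) (by positivity)).1 ?_
    rw [l2norm_sq (hmem n)]
    refine le_trans (le_of_eq ?_) h
    congr 1
    funext x
    rw [hf, norm_smul, mul_pow, norm_inv, inv_pow, Real.norm_eq_abs, sq_abs,
      Real.sq_sqrt (hpos n x).le]
    ring
  have hae : ∀ᵐ x : RSpace d, x ≠ 0 := by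
    have := (measure_singleton (μ := (volume : Measure (RSpace d))) 0)
    exact compl_mem_ae_iff.2 this
  have hlim : ∀ᵐ x, Filter.Tendsto (fun n => f n x) Filter.atTop (nhds (‖x‖⁻¹ • φ x)) := by
    filter_upwards [hae] with x hx
    refine Filter.Tendsto.smul_const ?_ _
    have h1 : Filter.Tendsto (fun n : ℕ => ‖x‖ ^ 2 + 1 / ((n : ℝ) + 1)) Filter.atTop
        (nhds (‖x‖ ^ 2 + 0)) := tendsto_const_nhds.add tendsto_one_div_add_atTop_nhds_zero_nat
    have h2 := (Real.continuous_sqrt.tendsto _).comp h1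
    rw [add_zero, Real.sqrt_sq (norm_nonneg x)] at h2
    exact h2.inv₀ (norm_ne_zero_iff.2 hx)
  have hm : AEStronglyMeasurable (fun x => ‖x‖⁻¹ • φ x) (volume : Measure (RSpace d)) :=
    aestronglyMeasurable_of_tendsto_ae Filter.atTop (fun n => (hmem n).1) hlim
  -- Fatou's lemma, with regularisation `ε = 1/(n+1)` tending to zero, gives both membership in `L²`
  -- and the bound.
  have hE : eLpNorm (fun x => ‖x‖⁻¹ • φ x) 2 (volume : Measure (RSpace d)) ≤
      ENNReal.ofReal (2 / ((d : ℝ) - 2) * N) := by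
    refine (Lp.eLpNorm_lim_le_liminf_eLpNorm (fun n => (hmem n).1) _ hlim).trans ?_
    refine Filter.liminf_le_of_le (by isBoundedDefault) fun b hb => ?_
    obtain ⟨n, hn⟩ := hb.exists
    refine hn.trans ?_
    rw [← ENNReal.ofReal_toReal (hmem n).2.ne]
    exact ENNReal.ofReal_le_ofReal (hle n)
  refine ⟨⟨hm, hE.trans_lt ENNReal.ofReal_lt_top⟩, ?_⟩
  exact ENNReal.toReal_le_of_le_ofReal (by positivity) hE

/-! ### Dirac operators with a critically decaying potential -/

/-- Symmetric Clifford generators `a_j`, a symmetric `b` anticommuting with them, and a symmetric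
matrix potential `W` with critical decay, such that `(x·∇){W, b}` decays one order faster. -/
structure IsDecayingDirac {d : ℕ} (a : Fin d → Spinor d →L[ℂ] Spinor d)
    (b : Spinor d →L[ℂ] Spinor d) (W : RSpace d → Spinor d →L[ℂ] Spinor d) (C₁ C₃ : ℝ) : Prop where
  a_symm : ∀ j u v, inner ℂ (a j u) v = inner ℂ u (a j v)
  b_symm : ∀ u v, inner ℂ (b u) v = inner ℂ u (b v)
  a_anticomm : ∀ j k u, a j (a k u) + a k (a j u) = if j = k then (2 : ℂ) • u else 0
  ab_anticomm : ∀ j u, a j (b u) + b (a j u) = 0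
  smooth : ∀ x, x ≠ 0 → ContDiffAt ℝ 1 W x
  symm : ∀ x, x ≠ 0 → ∀ u v, inner ℂ (W x u) v = inner ℂ u (W x v)
  bound : ∀ x, x ≠ 0 → ‖W x‖ ≤ C₁ / ‖x‖
  euler : ∀ x, x ≠ 0 → ‖fderiv ℝ W x x‖ ≤ C₁ / ‖x‖
  euler_b : ∀ x, x ≠ 0 → ∀ u,
    ‖fderiv ℝ W x x (b u) + b (fderiv ℝ W x x u)‖ ≤ C₃ / ‖x‖ ^ 2 * ‖u‖

/-- The massless free Dirac operator `-i ∑ a_j ∂_j`. -/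
noncomputable def kinetic {d : ℕ} (a : Fin d → Spinor d →L[ℂ] Spinor d)
    (φ : RSpace d → Spinor d) (x : RSpace d) : Spinor d :=
  ∑ j, ((-Complex.I) • a j) (partialD j φ x)

theorem ae_ne_zero {d : ℕ} (hd : 3 ≤ d) : ∀ᵐ x : RSpace d, x ≠ 0 := by
  have : Nonempty (Fin d) := ⟨⟨0, by omega⟩⟩
  have := (measure_singleton (μ := (volume : Measure (RSpace d))) 0)
  exact compl_mem_ae_iff.2 this

theorem aestronglyMeasurable_of_continuousAt {d : ℕ} (hd : 3 ≤ d) {f : RSpace d → Spinor d}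
    (hf : ∀ x, x ≠ 0 → ContinuousAt f x) : AEStronglyMeasurable f volume := by
  have h : ContinuousOn f {0}ᶜ := fun x hx => (hf x hx).continuousWithinAt
  have h2 := h.aestronglyMeasurable (μ := volume) (measurableSet_singleton _).compl
  have h3 : ∀ᵐ x : RSpace d, x ∈ ({0} : Set (RSpace d))ᶜ := ae_ne_zero hd
  rwa [Measure.restrict_eq_self_of_ae_mem h3] at h2

theorem memLp_clm_comp {d : ℕ} (M : Spinor d →L[ℂ] Spinor d) {f : RSpace d → Spinor d}
    (hf : MemLp f 2 volume) : MemLp (fun x => M (f x)) 2 volume :=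
  M.comp_memLp' hf

theorem memLp_complex_smul {d : ℕ} (c : ℂ) {f : RSpace d → Spinor d}
    (hf : MemLp f 2 volume) : MemLp (fun x => c • f x) 2 volume :=
  memLp_clm_comp (c • .id ℂ (Spinor d)) hf

section Kinetic

variable {d : ℕ} {a : Fin d → Spinor d →L[ℂ] Spinor d} {b : Spinor d →L[ℂ] Spinor d}
  {W : RSpace d → Spinor d →L[ℂ] Spinor d} {C₁ C₃ : ℝ} {φ : RSpace d → Spinor d}

theorem kinetic_memLp (hφ : IsTestFunction φ) : MemLp (kinetic a φ) 2 volume :=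
  memLp_finsetSum _ fun j _ => memLp_clm_comp ((-Complex.I) • a j) (hφ.partialD j).memLp

theorem IsDecayingDirac.l2norm_kinetic_sq (h : IsDecayingDirac a b W C₁ C₃)
    (hφ : IsTestFunction φ) :
    l2norm (kinetic a φ) ^ 2 = ∑ j, ∫ x, ‖partialD j φ x‖ ^ 2 := by
  rw [← integral_norm_sq_sum_clifford hφ a h.a_symm h.a_anticomm, l2norm_sq (kinetic_memLp hφ)]
  congr 1
  funext x
  simp only [kinetic, smul_apply, ← Finset.smul_sum, norm_smul]
  simp

theorem IsDecayingDirac.l2norm_partialD_le (h : IsDecayingDirac a b W C₁ C₃)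
    (hφ : IsTestFunction φ) (j : Fin d) : l2norm (partialD j φ) ≤ l2norm (kinetic a φ) := by
  refine (sq_le_sq₀ (l2norm_nonneg _) (l2norm_nonneg _)).1 ?_
  rw [h.l2norm_kinetic_sq hφ, l2norm_sq (hφ.partialD j).memLp]
  exact Finset.single_le_sum (f := fun j => ∫ x, ‖partialD j φ x‖ ^ 2)
    (fun i _ => integral_nonneg fun x => by positivity) (Finset.mem_univ j)

theorem IsDecayingDirac.hardy (h : IsDecayingDirac a b W C₁ C₃) (hd : 3 ≤ d)
    (hφ : IsTestFunction φ) : MemLp (fun x => ‖x‖⁻¹ • φ x) 2 volume ∧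
      l2norm (fun x => ‖x‖⁻¹ • φ x) ≤ 2 / ((d : ℝ) - 2) * l2norm (kinetic a φ) :=
  _root_.hardy hd hφ (l2norm_nonneg _) (h.l2norm_kinetic_sq hφ)

/-- Hardy turns decay `C₁/|x|` into a bound relative to the kinetic term. It is applied both to `K =
W` and to `K = x·∇W`, which is why the same `C₁` serves for the two. -/
theorem IsDecayingDirac.l2norm_critical_le (h : IsDecayingDirac a b W C₁ C₃) (hd : 3 ≤ d)
    (hφ : IsTestFunction φ) {K : RSpace d → Spinor d →L[ℂ] Spinor d} (hC : 0 ≤ C₁)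
    (hK : ∀ x, x ≠ 0 → ContinuousAt K x) (hb : ∀ x, x ≠ 0 → ‖K x‖ ≤ C₁ / ‖x‖) :
    MemLp (fun x => K x (φ x)) 2 volume ∧
      l2norm (fun x => K x (φ x)) ≤ 2 * C₁ / ((d : ℝ) - 2) * l2norm (kinetic a φ) := by
  obtain ⟨h1, h2⟩ := h.hardy hd hφ
  have hle : ∀ᵐ x, ‖K x (φ x)‖ ≤ C₁ * ‖‖x‖⁻¹ • φ x‖ := by
    filter_upwards [ae_ne_zero hd] with x hx
    rw [norm_smul, norm_inv, norm_norm, ← mul_assoc, ← div_eq_mul_inv]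
    exact ((K x).le_opNorm _).trans (by gcongr; exact hb x hx)
  refine ⟨h1.of_le_mul (aestronglyMeasurable_of_continuousAt hd fun x hx =>
    (hK x hx).clm_apply hφ.continuous.continuousAt) hle, ?_⟩
  refine (l2norm_le_mul_of_ae h1 hC hle).trans ?_
  calc C₁ * l2norm (fun x => ‖x‖⁻¹ • φ x)
      ≤ C₁ * (2 / ((d : ℝ) - 2) * l2norm (kinetic a φ)) := by gcongr
    _ = _ := by ring

theorem IsDecayingDirac.continuousAt_euler (h : IsDecayingDirac a b W C₁ C₃) {x : RSpace d}
    (hx : x ≠ 0) : ContinuousAt (fun x => fderiv ℝ W x x) x :=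
  (((h.smooth x hx).fderiv_right (m := 0) (by simp)).continuousAt).clm_apply continuousAt_id

/-- Differentiate the symmetry relation of `W`, which holds on a whole neighbourhood of `x`. -/
theorem IsDecayingDirac.euler_symm (h : IsDecayingDirac a b W C₁ C₃) {x : RSpace d} (hx : x ≠ 0)
    (v : RSpace d) (u w : Spinor d) :
    inner ℂ (fderiv ℝ W x v u) w = inner ℂ u (fderiv ℝ W x v w) := by
  have hW := ((h.smooth x hx).differentiableAt (by simp)).hasFDerivAt
  have hR := (ContinuousLinearMap.restrictScalarsL ℂ (Spinor d) (Spinor d) ℝ ℝ).hasFDerivAt.comp x hW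
  have h1 := (hR.clm_apply (hasFDerivAt_const u x)).inner ℂ (hasFDerivAt_const w x)
  have h2 := (hasFDerivAt_const u x).inner ℂ (hR.clm_apply (hasFDerivAt_const w x))
  have he : (fun y => inner ℂ (W y u) w) =ᶠ[nhds x] fun y => inner ℂ u (W y w) := by
    filter_upwards [isOpen_ne.mem_nhds hx] with y hy
    exact h.symm y hy u w
  have h3 := (h1.congr_of_eventuallyEq he.symm).unique h2
  have h4 := congrArg (fun L => L v) h3
  simpa [fderivInnerCLM_apply] using h4

end Kinetic

/-! ### Positivity of the dilation commutator -/

/-- A quadratic-form lower bound for perturbations of relative size at most `t ≤ 1/2`. -/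
theorem re_inner_add_sub_ge {H : Type*} [NormedAddCommGroup H] [InnerProductSpace ℂ H] (P w y : H)
    {t : ℝ} (ht : t ≤ 1 / 2) (hw : ‖w‖ ≤ t * ‖P‖) (hy : ‖y‖ ≤ t * ‖P‖) :
    (1 - 2 * t) * ‖P‖ ^ 2 ≤ (inner ℂ (P + w) (P - y)).re := by
  have e1 : (inner ℂ (P + w) (P - y)).re =
      ‖P‖ ^ 2 - (inner ℂ P (y - w)).re - (inner ℂ w y).re := by
    have h1 : (inner ℂ P P).re = ‖P‖ ^ 2 := by
      have := inner_self_eq_norm_sq (𝕜 := ℂ) P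
      simpa using this
    have h2 : (inner ℂ w P).re = (inner ℂ P w).re := by
      rw [← inner_conj_symm, Complex.conj_re]
    simp only [inner_add_left, inner_sub_right, Complex.add_re, Complex.sub_re, h1, h2]
    ring
  -- Bounding `⟨P, y - w⟩` and `⟨w, y⟩` separately would lose an extra `t²`. Polarisation expresses
  -- `⟨w, y⟩` through `u = ‖y - w‖`; the resulting bound `‖P‖² - u‖P‖ + u²/2 - t²‖P‖²` decreases for
  -- `u ≤ ‖P‖`, and at `u = 2t‖P‖` it equals `(1 - t)²‖P‖²`. This is where `t ≤ 1/2` is needed.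
  have e2 : ‖y - w‖ ^ 2 = ‖y‖ ^ 2 - 2 * (inner ℂ w y).re + ‖w‖ ^ 2 := by
    have h : (inner ℂ w y).re = (inner ℂ y w).re := by
      rw [← inner_conj_symm, Complex.conj_re]
    rw [h]
    exact norm_sub_sq (𝕜 := ℂ) y w
  have h3 : (inner ℂ P (y - w)).re ≤ ‖P‖ * ‖y - w‖ :=
    (Complex.re_le_norm _).trans (norm_inner_le_norm _ _)
  have h4 : ‖y - w‖ ≤ 2 * t * ‖P‖ := (norm_sub_le _ _).trans (by linarith)
  have hw2 : ‖w‖ ^ 2 ≤ (t * ‖P‖) ^ 2 := by gcongr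
  have hy2 : ‖y‖ ^ 2 ≤ (t * ‖P‖) ^ 2 := by gcongr
  have hP := norm_nonneg P
  have hu := norm_nonneg (y - w)
  rw [e1]
  nlinarith [mul_nonneg (sub_nonneg.2 h4)
    (by nlinarith : 0 ≤ 2 * ‖P‖ - ‖y - w‖ - 2 * t * ‖P‖), sq_nonneg (t * ‖P‖)]

section Estimates

variable {d : ℕ} {a : Fin d → Spinor d →L[ℂ] Spinor d} {b : Spinor d →L[ℂ] Spinor d}
  {W : RSpace d → Spinor d →L[ℂ] Spinor d} {C₁ C₃ : ℝ} {φ : RSpace d → Spinor d}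

/-- The operator `-i ∑ a_j ∂_j + m b + W - E`. -/
noncomputable def shiftedDirac (a : Fin d → Spinor d →L[ℂ] Spinor d)
    (b : Spinor d →L[ℂ] Spinor d) (W : RSpace d → Spinor d →L[ℂ] Spinor d) (m E : ℝ)
    (φ : RSpace d → Spinor d) (x : RSpace d) : Spinor d :=
  kinetic a φ x + ((m : ℂ) • b (φ x) + W x (φ x) - (E : ℂ) • φ x)

/-- The density `-i ∑ a_j ∂_j φ - (x·∇W) φ` obtained by commuting the Dirac operator with the
generator of dilations. -/
noncomputable def dilationCommutator (a : Fin d → Spinor d →L[ℂ] Spinor d)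
    (W : RSpace d → Spinor d →L[ℂ] Spinor d) (φ : RSpace d → Spinor d) (x : RSpace d) : Spinor d :=
  kinetic a φ x - fderiv ℝ W x x (φ x)

/-- For symmetric `K` the integrand is half of the total derivative `∂_j⟨φ, Kφ⟩`. -/
theorem integral_symm_first_order (hφ : IsTestFunction φ) (K : Spinor d →L[ℂ] Spinor d)
    (hK : ∀ u v, inner ℂ (K u) v = inner ℂ u (K v)) (j : Fin d) :
    ∫ x, (inner ℂ (φ x) (K (partialD j φ x))).re = 0 := by
  have hc : ContDiff ℝ 1 (fun x => (inner ℂ (φ x) (K (φ x))).re) :=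
    contDiff_re_inner (hφ.1.of_le (by simp)) (contDiff_clm_comp K (hφ.1.of_le (by simp)))
  have hs : HasCompactSupport (fun x => (inner ℂ (φ x) (K (φ x))).re) := by
    refine hφ.2.mono ?_
    intro x hx
    rw [Function.mem_support] at hx ⊢
    intro h
    simp [h] at hx
  have h := integral_partialD_eq_zero hc hs j
  have e : ∀ x, partialD j (fun x => (inner ℂ (φ x) (K (φ x))).re) x =
      2 * (inner ℂ (φ x) (K (partialD j φ x))).re := by
    intro x
    rw [partialD_re_inner (hφ.differentiable x)
      ((contDiff_clm_comp K hφ.1).differentiable (by simp) x),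
      partialD_clm_comp K (hφ.differentiable x), ← hK, ← inner_conj_symm (K _), Complex.conj_re]
    ring
  simp_rw [e] at h
  rw [integral_const_mul] at h
  linarith

namespace IsDecayingDirac

variable (h : IsDecayingDirac a b W C₁ C₃)
include h

/-- Because `a_j` and `b` are symmetric and anticommute, `-i b a_j` is symmetric, so each summand
integrates to zero. -/
theorem integral_mass_kinetic (hφ : IsTestFunction φ) :
    ∫ x, (inner ℂ (b (φ x)) (kinetic a φ x)).re = 0 := by
  have e : ∀ x, (inner ℂ (b (φ x)) (kinetic a φ x)).re =
      ∑ j, (inner ℂ (φ x) (((-Complex.I) • (b ∘L a j)) (partialD j φ x))).re := by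
    intro x
    rw [h.b_symm, kinetic, map_sum, inner_sum, Complex.re_sum]
    simp
  have hK : ∀ j u v, inner ℂ (((-Complex.I) • (b ∘L a j)) u) v =
      inner ℂ u (((-Complex.I) • (b ∘L a j)) v) := by
    intro j u v
    simp only [smul_apply, ContinuousLinearMap.comp_apply, inner_smul_left,
      inner_smul_right, h.b_symm, h.a_symm]
    rw [eq_neg_of_add_eq_zero_left (h.ab_anticomm j v), inner_neg_right]
    simp
  simp_rw [e]
  rw [integral_finsetSum]
  · exact Finset.sum_eq_zero fun j _ => integral_symm_first_order hφ _ (hK j) j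
  · intro j _
    exact integrable_re_inner_clm hφ (hφ.partialD j) (.id ℂ _) _

theorem memLp_shiftedDirac (hd : 3 ≤ d) (hC : 0 ≤ C₁) (hφ : IsTestFunction φ) (m E : ℝ) :
    MemLp (shiftedDirac a b W m E φ) 2 volume := by
  have h1 : MemLp (kinetic a φ) 2 volume := kinetic_memLp hφ
  have h2 := memLp_complex_smul (m : ℂ) (memLp_clm_comp b hφ.memLp)
  have h3 := (h.l2norm_critical_le hd hφ hC (fun x hx => (h.smooth x hx).continuousAt) h.bound).1
  have h4 := memLp_complex_smul (E : ℂ) hφ.memLp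
  exact h1.add ((h2.add h3).sub h4)

theorem memLp_euler (hd : 3 ≤ d) (hC : 0 ≤ C₁) (hφ : IsTestFunction φ) :
    MemLp (fun x => fderiv ℝ W x x (φ x)) 2 volume :=
  (h.l2norm_critical_le hd hφ hC (fun _ hx => h.continuousAt_euler hx) h.euler).1

theorem memLp_dilationCommutator (hd : 3 ≤ d) (hC : 0 ≤ C₁) (hφ : IsTestFunction φ) :
    MemLp (dilationCommutator a W φ) 2 volume :=
  (kinetic_memLp hφ).sub (h.memLp_euler hd hC hφ)

theorem l2norm_dilationCommutator_le (hd : 3 ≤ d) (hC : 0 ≤ C₁) (hφ : IsTestFunction φ)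
    (ht : 2 * C₁ / ((d : ℝ) - 2) ≤ 1) :
    l2norm (dilationCommutator a W φ) ≤ 2 * l2norm (kinetic a φ) := by
  have h1 := h.l2norm_critical_le hd hφ hC (fun _ hx => h.continuousAt_euler hx) h.euler
  have h2 := l2norm_sub_le (kinetic_memLp (a := a) hφ) h1.1
  have h3 := mul_le_mul_of_nonneg_right ht (l2norm_nonneg (kinetic a φ))
  have : l2norm (dilationCommutator a W φ) ≤ _ := h2
  linarith [h1.2]

/-- The gradient is controlled by the graph norm. -/
theorem kinetic_le (hd : 3 ≤ d) (hC : 0 ≤ C₁) (hφ : IsTestFunction φ) (m E : ℝ) :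
    (1 - 2 * C₁ / ((d : ℝ) - 2)) * l2norm (kinetic a φ) ≤
      l2norm (shiftedDirac a b W m E φ) + (|m| * ‖b‖ + |E|) * l2norm φ := by
  obtain ⟨h1, h2⟩ := h.l2norm_critical_le hd hφ hC (fun x hx => (h.smooth x hx).continuousAt)
    h.bound
  have hT := h.memLp_shiftedDirac hd hC hφ m E
  have hφm := hφ.memLp
  set R : RSpace d → Spinor d := fun x => (E : ℂ) • φ x - (m : ℂ) • b (φ x) with hR
  have hRm : MemLp R 2 volume :=
    (memLp_complex_smul (E : ℂ) hφm).sub (memLp_complex_smul (m : ℂ) (memLp_clm_comp b hφm))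
  -- Solving for the kinetic term makes `Wφ` an error of relative size `2C₁/(d-2)`, which is
  -- absorbed on the left.
  have e : kinetic a φ = fun x => (shiftedDirac a b W m E φ x + R x) - W x (φ x) := by
    funext x
    simp only [shiftedDirac, hR]
    abel
  have hRle : l2norm R ≤ (|m| * ‖b‖ + |E|) * l2norm φ := by
    refine l2norm_le_mul_of_ae hφm (by positivity) (Filter.Eventually.of_forall fun x => ?_)
    refine (norm_sub_le _ _).trans ?_
    rw [norm_smul, norm_smul, Complex.norm_real, Complex.norm_real, Real.norm_eq_abs,
      Real.norm_eq_abs]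
    have := mul_le_mul_of_nonneg_left (b.le_opNorm (φ x)) (abs_nonneg m)
    linarith
  have h3 : l2norm (kinetic a φ) ≤ l2norm (shiftedDirac a b W m E φ) + l2norm R
      + l2norm (fun x => W x (φ x)) := by
    conv_lhs => rw [e]
    exact (l2norm_sub_le (hT.add hRm) h1).trans (by gcongr; exact l2norm_add_le hT hRm)
  linarith

/-- Positivity of the commutator, up to the virial term. -/
theorem kinetic_sq_le (hd : 3 ≤ d) (hC : 0 ≤ C₁) (hC₃ : 0 ≤ C₃)
    (ht : 2 * C₁ / ((d : ℝ) - 2) ≤ 1 / 2) (hφ : IsTestFunction φ) {m : ℝ} (hm : 0 ≤ m) (E : ℝ) :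
    (1 - 4 * C₁ / ((d : ℝ) - 2) - 2 * m * C₃ / ((d : ℝ) - 2) ^ 2) * l2norm (kinetic a φ) ^ 2 ≤
      |E| * |∫ x, (inner ℂ (φ x) (dilationCommutator a W φ x)).re|
        + 2 * l2norm (shiftedDirac a b W m E φ) * l2norm (kinetic a φ) := by
  have hd' : (0 : ℝ) < (d : ℝ) - 2 := by
    have : (3 : ℝ) ≤ d := by exact_mod_cast hd
    linarith
  obtain ⟨hw, hw2⟩ := h.l2norm_critical_le hd hφ hC
    (fun x hx => (h.smooth x hx).continuousAt) h.bound
  obtain ⟨hy, hy2⟩ := h.l2norm_critical_le hd hφ hC (fun _ hx => h.continuousAt_euler hx) h.euler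
  obtain ⟨hH, hH2⟩ := h.hardy hd hφ
  have hP : MemLp (kinetic a φ) 2 volume := kinetic_memLp hφ
  have hX := h.memLp_dilationCommutator hd hC hφ
  have hX2 := h.l2norm_dilationCommutator_le hd hC hφ (by linarith)
  have hT := h.memLp_shiftedDirac hd hC hφ m E
  have hφm := hφ.memLp
  have hbm := memLp_clm_comp b hφm
  -- The form bound in `L²`, with `w = Wφ` and `y = (x·∇W)φ`.
  have h1 := re_inner_add_sub_ge (hP.toLp _) (hw.toLp _) (hy.toLp _) ht
    (by rwa [← l2norm_eq_norm_toLp, ← l2norm_eq_norm_toLp])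
    (by rwa [← l2norm_eq_norm_toLp, ← l2norm_eq_norm_toLp])
  rw [← l2norm_eq_norm_toLp, ← MemLp.toLp_add, ← MemLp.toLp_sub,
    toLp_re_inner (hP.add hw) (hP.sub hy)] at h1
  -- `P + Wφ` is the residual plus `Eφ - m bφ`. Against the commutator, `Eφ` gives the virial term;
  -- `bφ` pairs to zero with `P`, which leaves only its pairing with `(x·∇W)φ`.
  have e1 : ∀ x, (inner ℂ ((kinetic a φ + fun x => W x (φ x)) x)
      ((kinetic a φ - fun x => fderiv ℝ W x x (φ x)) x)).re =
      (inner ℂ (shiftedDirac a b W m E φ x) (dilationCommutator a W φ x)).re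
      + E * (inner ℂ (φ x) (dilationCommutator a W φ x)).re
      - m * (inner ℂ (b (φ x)) (kinetic a φ x)).re
      + m * (inner ℂ (b (φ x)) (fderiv ℝ W x x (φ x))).re := by
    intro x
    have : (kinetic a φ + fun x => W x (φ x)) x =
        shiftedDirac a b W m E φ x + (E : ℂ) • φ x - (m : ℂ) • b (φ x) := by
      simp only [shiftedDirac, Pi.add_apply]
      abel
    rw [this]
    simp only [Pi.sub_apply, dilationCommutator, inner_sub_left, inner_add_left, inner_smul_left,
      Complex.conj_ofReal, Complex.sub_re, Complex.add_re, Complex.re_ofReal_mul, inner_sub_right]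
    ring
  simp_rw [e1] at h1
  have i1 := integrable_re_inner hT hX
  have i2 := (integrable_re_inner hφm hX).const_mul E
  have i3 := (integrable_re_inner hbm hP).const_mul m
  have i4 := (integrable_re_inner hbm hy).const_mul m
  have i12 : Integrable fun x =>
      (inner ℂ (shiftedDirac a b W m E φ x) (dilationCommutator a W φ x)).re
      + E * (inner ℂ (φ x) (dilationCommutator a W φ x)).re := i1.add i2
  have i123 : Integrable fun x =>
      (inner ℂ (shiftedDirac a b W m E φ x) (dilationCommutator a W φ x)).re
      + E * (inner ℂ (φ x) (dilationCommutator a W φ x)).re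
      - m * (inner ℂ (b (φ x)) (kinetic a φ x)).re := i12.sub i3
  rw [integral_add i123 i4, integral_sub i12 i3, integral_add i1 i2,
    integral_const_mul, integral_const_mul, integral_const_mul,
    h.integral_mass_kinetic hφ] at h1
  have h2 := abs_integral_re_inner_le hT hX
  have h3 : ∫ x, (inner ℂ (b (φ x)) (fderiv ℝ W x x (φ x))).re ≤
      C₃ / 2 * l2norm (fun x => ‖x‖⁻¹ • φ x) ^ 2 := by
    rw [l2norm_sq hH, ← integral_const_mul]
    refine integral_mono_ae (integrable_re_inner hbm hy)
      ((hH.norm.integrable_sq).const_mul _) ?_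
    filter_upwards [ae_ne_zero hd] with x hx
    -- Symmetry of `b` and of `x·∇W` turns the real part into half the expectation of their
    -- anticommutator, to which the `C₃` bound applies; Hardy then contributes `4/(d-2)²`.
    have s1 : (inner ℂ (b (φ x)) (fderiv ℝ W x x (φ x))).re =
        (inner ℂ (φ x) (fderiv ℝ W x x (b (φ x)) + b (fderiv ℝ W x x (φ x)))).re / 2 := by
      rw [inner_add_right, ← h.b_symm, Complex.add_re,
        ← inner_conj_symm (φ x) (fderiv ℝ W x x (b (φ x))), Complex.conj_re, h.euler_symm hx]
      ring
    rw [s1]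
    have s2 := (abs_le.1 (abs_re_inner_le (φ x)
      (fderiv ℝ W x x (b (φ x)) + b (fderiv ℝ W x x (φ x))))).2
    have s3 := mul_le_mul_of_nonneg_left (h.euler_b x hx (φ x)) (norm_nonneg (φ x))
    have s4 : C₃ / 2 * ‖‖x‖⁻¹ • φ x‖ ^ 2 = ‖φ x‖ * (C₃ / ‖x‖ ^ 2 * ‖φ x‖) / 2 := by
      rw [norm_smul, norm_inv, norm_norm]
      field_simp
    refine le_trans ?_ s4.ge
    linarith
  have h4 : l2norm (fun x => ‖x‖⁻¹ • φ x) ^ 2 ≤ (2 / ((d : ℝ) - 2) * l2norm (kinetic a φ)) ^ 2 := by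
    gcongr
    exact l2norm_nonneg _
  have h5 : m * ∫ x, (inner ℂ (b (φ x)) (fderiv ℝ W x x (φ x))).re ≤
      2 * m * C₃ / ((d : ℝ) - 2) ^ 2 * l2norm (kinetic a φ) ^ 2 := by
    refine (mul_le_mul_of_nonneg_left (h3.trans
      (mul_le_mul_of_nonneg_left h4 (by positivity))) hm).trans (le_of_eq ?_)
    field_simp
  have h6 : E * ∫ x, (inner ℂ (φ x) (dilationCommutator a W φ x)).re ≤
      |E| * |∫ x, (inner ℂ (φ x) (dilationCommutator a W φ x)).re| := by
    rw [← abs_mul]; exact le_abs_self _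
  have h7 := mul_le_mul_of_nonneg_left hX2 (l2norm_nonneg (shiftedDirac a b W m E φ))
  have h8 := le_abs_self (∫ x, (inner ℂ (shiftedDirac a b W m E φ x) (dilationCommutator a W φ x)).re)
  have h9 : 2 * (2 * C₁ / ((d : ℝ) - 2)) = 4 * C₁ / ((d : ℝ) - 2) := by ring
  rw [h9] at h1
  nlinarith

end IsDecayingDirac

end Estimates

/-! ### Quantitative virial bound for a fixed cutoff -/

theorem memLp_bounded_smul {d : ℕ} {q : RSpace d → ℝ} (hq : Continuous q) {c : ℝ} (hc : 0 ≤ c)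
    (hqc : ∀ x, |q x| ≤ c) {f : RSpace d → Spinor d} (hf : MemLp f 2 volume) :
    MemLp (fun x => q x • f x) 2 volume ∧ l2norm (fun x => q x • f x) ≤ c * l2norm f := by
  have hle : ∀ᵐ x, ‖q x • f x‖ ≤ c * ‖f x‖ := Filter.Eventually.of_forall fun x => by
    rw [norm_smul, Real.norm_eq_abs]
    gcongr
    exact hqc x
  exact ⟨hf.of_le_mul (hq.aestronglyMeasurable.smul hf.1) hle, l2norm_le_mul_of_ae hf hc hle⟩

theorem memLp_sum_of_le {d : ℕ} (f : Fin d → RSpace d → Spinor d) (c : ℝ)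
    (hf : ∀ i, MemLp (f i) 2 volume ∧ l2norm (f i) ≤ c) :
    MemLp (fun x => ∑ i, f i x) 2 volume ∧ l2norm (fun x => ∑ i, f i x) ≤ d * c := by
  refine ⟨memLp_finsetSum _ fun i _ => (hf i).1, (l2norm_sum_le _ fun i => (hf i).1).trans ?_⟩
  refine (Finset.sum_le_sum fun i _ => (hf i).2).trans (le_of_eq ?_)
  simp

theorem abs_coord_le {d : ℕ} (x : RSpace d) (k : Fin d) : |x k| ≤ ‖x‖ := by
  have h := PiLp.norm_apply_le x k
  simpa using h

theorem fderiv_apply_eq_sum {d : ℕ} {F : Type*} [NormedAddCommGroup F] [NormedSpace ℝ F]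
    (f : RSpace d → F) (x v : RSpace d) : fderiv ℝ f x v = ∑ j, v j • partialD j f x := by
  have hv : v = ∑ k, v k • EuclideanSpace.single k (1 : ℝ) := by
    ext i
    simp [Finset.sum_apply, Pi.single_apply]
  conv_lhs => rw [hv]
  rw [map_sum]
  simp only [map_smul, partialD]

theorem sum_smul_partialD {d : ℕ} (W : RSpace d → Spinor d →L[ℂ] Spinor d) (x : RSpace d)
    (u : Spinor d) : ∑ k, x k • partialD k W x u = fderiv ℝ W x x u := by
  rw [fderiv_apply_eq_sum, sum_apply]
  rfl

section Virial

variable {d : ℕ} {a : Fin d → Spinor d →L[ℂ] Spinor d} {b : Spinor d →L[ℂ] Spinor d}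
  {W : RSpace d → Spinor d →L[ℂ] Spinor d} {C₁ C₃ : ℝ} {φ : RSpace d → Spinor d}

theorem IsDecayingDirac.norm_a (h : IsDecayingDirac a b W C₁ C₃) (j : Fin d) (u : Spinor d) :
    ‖a j u‖ = ‖u‖ := by
  have h1 := h.a_anticomm j j u
  rw [if_pos rfl, ← two_smul ℂ] at h1
  have h2 : a j (a j u) = u := smul_right_injective _ (two_ne_zero' ℂ) h1
  have h3 : ‖a j u‖ ^ 2 = ‖u‖ ^ 2 := by
    rw [← re_inner_self_eq, ← re_inner_self_eq, h.a_symm, h2]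
  exact (sq_eq_sq₀ (norm_nonneg _) (norm_nonneg _)).1 h3

/-- Three errors arise: replacing `1` by `g` in the expectation, pairing the residual with the
multiplier field `Z`, and the terms `U` containing derivatives of `g`. The size `R` of the cutoff,
which cannot stay bounded, occurs only multiplied by the residual, while `δ` measures the
scale-invariant quantity `|x||∇g|`. -/
theorem IsDecayingDirac.virial_le (h : IsDecayingDirac a b W C₁ C₃) (hd : 3 ≤ d) (hC : 0 ≤ C₁)
    (ht : 2 * C₁ / ((d : ℝ) - 2) ≤ 1) (hφ : IsTestFunction φ) (m E : ℝ) {g : RSpace d → ℝ}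
    (hg : ContDiff ℝ 1 g) (h0 : ∀ᶠ x in nhds 0, g x = 0) (hg1 : ∀ x, |g x| ≤ 1) {R δ : ℝ}
    (hR0 : 0 ≤ R) (hδ0 : 0 ≤ δ) (hR : ∀ x, ‖x‖ * |g x| ≤ R)
    (hδ : ∀ j x, ‖x‖ * |partialD j g x| ≤ δ) :
    |∫ x, (inner ℂ (φ x) (dilationCommutator a W φ x)).re| ≤
      2 * l2norm (fun x => (1 - g x) • φ x) * l2norm (kinetic a φ)
      + 2 * l2norm (shiftedDirac a b W m E φ)
        * (d * R * l2norm (kinetic a φ) + (d + d * δ) / 2 * l2norm φ)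
      + d ^ 2 * δ * l2norm (kinetic a φ) * l2norm φ := by
  set s : Fin d → Spinor d →L[ℂ] Spinor d := fun j => (-Complex.I) • a j with hs
  have hskew : ∀ j u v, (inner ℂ (s j u) v).re = -(inner ℂ (s j v) u).re := by
    intro j u v
    simp only [hs, smul_apply, inner_smul_left]
    have e : (inner ℂ u (a j v)).im = -(inner ℂ (a j v) u).im := by
      rw [← inner_conj_symm, Complex.conj_im]
    rw [h.a_symm]
    simp [e]
  have hsn : ∀ j u, ‖s j u‖ = ‖u‖ := by
    intro j u
    simp [hs, norm_smul, h.norm_a]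
  -- Mass and energy are put into the zeroth-order term; being constant, they do not contribute to
  -- `x·∇M`.
  set M : RSpace d → Spinor d →L[ℂ] Spinor d :=
    fun x => (m : ℂ) • b + W x - (E : ℂ) • .id ℂ (Spinor d) with hM
  have hMd : ∀ x, x ≠ 0 → ContDiffAt ℝ 1 M x := fun x hx =>
    (contDiffAt_const.add (h.smooth x hx)).sub contDiffAt_const
  have hMs : ∀ x, x ≠ 0 → ∀ u v, inner ℂ (M x u) v = inner ℂ u (M x v) := by
    intro x hx u v
    simp only [hM, sub_apply, add_apply, smul_apply, ContinuousLinearMap.id_apply, inner_add_left,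
      inner_sub_left, inner_add_right, inner_sub_right, inner_smul_left, inner_smul_right,
      h.b_symm, h.symm x hx, Complex.conj_ofReal]
  have hMp : ∀ x, fderiv ℝ M x = fderiv ℝ W x := by
    intro x
    simp only [hM]
    rw [fderiv_sub_const, fderiv_const_add]
  have key := integral_virial_cutoff hφ s hskew hMd hMs hg h0
  have cg : Continuous g := hg.continuous
  have cx : ∀ k : Fin d, Continuous fun x : RSpace d => x k := fun k =>
    (contDiff_coord (n := 0) k).continuous
  have cp : ∀ k, Continuous fun x => partialD k g x := fun k =>
    (hg.continuous_fderiv (by simp)).clm_apply continuous_const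
  have hN := l2norm_nonneg (kinetic a φ)
  have hφm := hφ.memLp
  have b1 : ∀ k x, |g x * x k| ≤ R := fun k x => by
    rw [abs_mul, mul_comm]
    exact (mul_le_mul_of_nonneg_right (abs_coord_le x k) (abs_nonneg _)).trans (hR x)
  have b2 : ∀ j k x, |partialD j g x * x k| ≤ δ := fun j k x => by
    rw [abs_mul, mul_comm]
    exact (mul_le_mul_of_nonneg_right (abs_coord_le x k) (abs_nonneg _)).trans (hδ j x)
  have b3 : ∀ x, |(d * g x + ∑ k, x k * partialD k g x) / 2| ≤ (d + d * δ) / 2 := fun x => by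
    rw [abs_div, abs_two]
    gcongr
    refine (abs_add_le _ _).trans (add_le_add ?_ ?_)
    · rw [abs_mul, Nat.abs_cast]
      exact mul_le_of_le_one_right (by positivity) (hg1 x)
    · refine (Finset.abs_sum_le_sum_abs _ _).trans ?_
      refine (Finset.sum_le_sum fun k _ => (by rw [mul_comm]; exact b2 k k x :
        |x k * partialD k g x| ≤ δ)).trans ?_
      simp
  have z1 := fun k => memLp_bounded_smul (cg.mul (cx k)) hR0 (b1 k) (hφ.partialD k).memLp
  have z2 := memLp_bounded_smul (q := fun x => (d * g x + ∑ k, x k * partialD k g x) / 2)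
    (((continuous_const.mul cg).add (continuous_finsetSum _ fun k _ =>
    (cx k).mul (cp k))).div_const 2) (by positivity) b3 hφm
  obtain ⟨z3, z3n⟩ := memLp_sum_of_le (fun k x => (g x * x k) • partialD k φ x) _ fun k =>
    ⟨(z1 k).1, (z1 k).2.trans (mul_le_mul_of_nonneg_left (h.l2norm_partialD_le hφ k) hR0)⟩
  rw [← mul_assoc] at z3n
  have z4 := fun j k => memLp_bounded_smul ((cp j).mul (cx k)) hδ0 (b2 j k)
    (memLp_clm_comp (s j) (hφ.partialD k).memLp)
  have z4n : ∀ j k, l2norm (fun x => (partialD j g x * x k) • s j (partialD k φ x)) ≤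
      δ * l2norm (kinetic a φ) := by
    intro j k
    refine (z4 j k).2.trans (mul_le_mul_of_nonneg_left ?_ hδ0)
    refine le_trans ?_ (h.l2norm_partialD_le hφ k)
    have := l2norm_le_mul_of_ae (f := fun x => s j (partialD k φ x)) (hφ.partialD k).memLp zero_le_one
      (Filter.Eventually.of_forall fun x => by rw [hsn, one_mul])
    rwa [one_mul] at this
  set U : RSpace d → Spinor d :=
    fun x => ∑ j, ∑ k, (partialD j g x * x k) • s j (partialD k φ x) with hU
  obtain ⟨hUm, hUn⟩ : MemLp U 2 volume ∧ l2norm U ≤ d ^ 2 * δ * l2norm (kinetic a φ) := by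
    have := memLp_sum_of_le _ _ fun j => memLp_sum_of_le _ _ fun k => ⟨(z4 j k).1, z4n j k⟩
    refine ⟨this.1, this.2.trans (le_of_eq ?_)⟩
    ring
  set Z : RSpace d → Spinor d := fun x => ∑ k, (g x * x k) • partialD k φ x
    + ((d * g x + ∑ k, x k * partialD k g x) / 2) • φ x with hZ
  have hZm : MemLp Z 2 volume := z3.add z2.1
  have hZn : l2norm Z ≤ d * R * l2norm (kinetic a φ) + (d + d * δ) / 2 * l2norm φ :=
    (l2norm_add_le z3 z2.1).trans (add_le_add z3n z2.2)
  have hT := h.memLp_shiftedDirac hd hC hφ m E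
  have hX := h.memLp_dilationCommutator hd hC hφ
  have hXn := h.l2norm_dilationCommutator_le hd hC hφ ht
  have hgφ := (memLp_bounded_smul cg zero_le_one hg1 hφm).1
  have hgφ' : MemLp (fun x => (1 - g x) • φ x) 2 volume :=
    (memLp_bounded_smul (q := fun x => 1 - g x) (continuous_const.sub cg) zero_le_two (fun x => by
      have := hg1 x
      rw [abs_le] at this ⊢
      constructor <;> linarith) hφm).1
  have i1 := (integrable_re_inner hT hZm).const_mul 2
  have i2 := integrable_re_inner hgφ hX
  have i3 := integrable_re_inner hUm hφm
  have i4 := integrable_re_inner hgφ' hX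
  have key2 : ∫ x, (2 * (inner ℂ (shiftedDirac a b W m E φ x) (Z x)).re
      - (inner ℂ (g x • φ x) (dilationCommutator a W φ x)).re - (inner ℂ (U x) (φ x)).re) = 0 := by
    rw [← key]
    refine integral_congr_ae ?_
    filter_upwards [ae_ne_zero hd] with x hx
    have e1 : ∑ j, s j (partialD j φ x) + M x (φ x) = shiftedDirac a b W m E φ x := rfl
    have e2 : ∑ j, s j (partialD j φ x) = kinetic a φ x := rfl
    have e3 : ∑ k, x k • partialD k M x (φ x) = fderiv ℝ W x x (φ x) := by
      rw [sum_smul_partialD, hMp]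
    have e4 : (inner ℂ (U x) (φ x)).re =
        ∑ j, ∑ k, partialD j g x * x k * (inner ℂ (s j (partialD k φ x)) (φ x)).re := by
      simp only [hU, sum_inner, Complex.re_sum, ← Complex.coe_smul, inner_smul_left,
        Complex.conj_ofReal, Complex.re_ofReal_mul]
    have e5 : (inner ℂ (g x • φ x) (dilationCommutator a W φ x)).re =
        g x * (inner ℂ (kinetic a φ x) (φ x)).re
          - g x * (inner ℂ (fderiv ℝ W x x (φ x)) (φ x)).re := by
      rw [← Complex.coe_smul, inner_smul_left, Complex.conj_ofReal, Complex.re_ofReal_mul,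
        ← inner_conj_symm, Complex.conj_re]
      simp only [dilationCommutator, inner_sub_left, Complex.sub_re]
      ring
    rw [e1, e2, e3, e4, e5]
    ring
  have i12 : Integrable fun x => 2 * (inner ℂ (shiftedDirac a b W m E φ x) (Z x)).re
      - (inner ℂ (g x • φ x) (dilationCommutator a W φ x)).re := i1.sub i2
  rw [integral_sub i12 i3, integral_sub i1 i2, integral_const_mul] at key2
  have hsplit : ∫ x, (inner ℂ (φ x) (dilationCommutator a W φ x)).re =
      (∫ x, (inner ℂ ((1 - g x) • φ x) (dilationCommutator a W φ x)).re)
      + ∫ x, (inner ℂ (g x • φ x) (dilationCommutator a W φ x)).re := by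
    rw [← integral_add i4 i2]
    congr 1
    funext x
    rw [← Complex.add_re, ← inner_add_left, ← add_smul, sub_add_cancel, one_smul]
  have n1 := abs_integral_re_inner_le hT hZm
  have n2 := abs_integral_re_inner_le hUm hφm
  have n3 := abs_integral_re_inner_le hgφ' hX
  have n4 := mul_le_mul_of_nonneg_left hZn (l2norm_nonneg (shiftedDirac a b W m E φ))
  have n5 := mul_le_mul_of_nonneg_right hUn (l2norm_nonneg φ)
  have n6 := mul_le_mul_of_nonneg_left hXn (l2norm_nonneg (fun x => (1 - g x) • φ x))
  rw [abs_le] at n1 n2 n3 ⊢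
  constructor <;> linarith

end Virial

/-! ### Removing the cutoff and passing to the limit -/

/-- The cutoff is a bump in the variable `log|x|² / (n+1)`. A cutoff at a single scale would only
keep `|x||∇g|` bounded; spreading the transition over logarithmic scales makes it `O(1/n)`. The
support lies in `e^{-(n+1)} ≤ |x| ≤ e^{n+1}`, whence `R n = e^{n+1}`. -/
theorem exists_dilation_cutoff (d : ℕ) : ∃ (g : ℕ → RSpace d → ℝ) (R δ : ℕ → ℝ),
    (∀ n, ContDiff ℝ 1 (g n)) ∧ (∀ n, ∀ᶠ x in 𝓝 0, g n x = 0) ∧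
    (∀ n x, 0 ≤ g n x) ∧ (∀ n x, g n x ≤ 1) ∧
    (∀ n, 0 ≤ R n) ∧ (∀ n, 0 ≤ δ n) ∧ (∀ n x, ‖x‖ * |g n x| ≤ R n) ∧
    (∀ n j x, ‖x‖ * |partialD j (g n) x| ≤ δ n) ∧ Tendsto δ atTop (𝓝 0) ∧
    ∀ x, x ≠ 0 → ∀ᶠ n in atTop, g n x = 1 := by
  classical
  let f : ContDiffBump (0 : ℝ) := ⟨1, 2, one_pos, one_lt_two⟩
  have hf : ContDiff ℝ 1 f := f.contDiff
  obtain ⟨K, hK⟩ : ∃ K, ∀ t, ‖deriv f t‖ ≤ K :=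
    (hf.continuous_deriv le_rfl).bounded_above_of_compact_support f.hasCompactSupport.deriv
  have hK0 : 0 ≤ K := (norm_nonneg _).trans (hK 0)
  let g : ℕ → RSpace d → ℝ := fun n x => if x = 0 then 0 else f (Real.log (‖x‖ ^ 2) / (n + 1))
  have hf0 : ∀ t : ℝ, 2 ≤ |t| → f t = 0 := fun t ht =>
    f.zero_of_le_dist (by simpa using ht)
  have hg0 : ∀ n, ∀ᶠ x in 𝓝 0, g n x = 0 := by
    intro n
    have : Metric.ball (0 : RSpace d) (Real.exp (-(n + 1))) ∈ 𝓝 0 :=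
      Metric.ball_mem_nhds _ (Real.exp_pos _)
    filter_upwards [this] with x hx
    by_cases h0 : x = 0
    · simp [g, h0]
    · have hx' : ‖x‖ < Real.exp (-(n + 1)) := by simpa using hx
      have hp := norm_pos_iff.2 h0
      have hl : Real.log ‖x‖ < -(n + 1) := (Real.log_lt_iff_lt_exp hp).2 hx'
      simp only [g, if_neg h0]
      apply hf0
      have hn : (0 : ℝ) < n + 1 := by positivity
      rw [Real.log_pow, abs_div, abs_of_pos hn, le_div_iff₀ hn]
      push_cast
      have : (2 : ℝ) * Real.log ‖x‖ ≤ -(2 * (n + 1)) := by linarith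
      linarith [neg_le_abs (2 * Real.log ‖x‖)]
  have hloc : ∀ n x, x ≠ 0 → g n =ᶠ[𝓝 x] fun y => f (Real.log (‖y‖ ^ 2) / (n + 1)) := by
    intro n x hx
    filter_upwards [isOpen_ne.mem_nhds hx] with y hy
    simp only [g, if_neg hy]
  have hgc : ∀ n, ContDiff ℝ 1 (g n) := by
    intro n
    rw [contDiff_iff_contDiffAt]
    intro x
    by_cases hx : x = 0
    · subst hx
      exact (contDiffAt_const (c := (0 : ℝ))).congr_of_eventuallyEq (hg0 n)
    · refine ContDiffAt.congr_of_eventuallyEq ?_ (hloc n x hx)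
      refine hf.contDiffAt.comp x ?_
      exact ((contDiff_norm_sq ℝ).contDiffAt.log (by positivity)).div_const _
  have hgd : ∀ n j x, ‖x‖ * |partialD j (g n) x| ≤ 2 * K * (1 / ((n : ℝ) + 1)) := by
    intro n j x
    by_cases hx : x = 0
    · subst hx
      simp
      positivity
    · have hs : ‖x‖ ^ 2 ≠ 0 := by positivity
      have e : partialD j (g n) x = partialD j (fun y : RSpace d =>
          f (Real.log (‖y‖ ^ 2) / (n + 1))) x := by
        simp only [partialD, (hloc n x hx).fderiv_eq]
      have h1 : HasDerivAt (fun s => f (Real.log s / (n + 1)))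
          (deriv f (Real.log (‖x‖ ^ 2) / (n + 1)) * ((‖x‖ ^ 2)⁻¹ / (n + 1))) (‖x‖ ^ 2) := by
        have hd := (hf.differentiable (by simp) (Real.log (‖x‖ ^ 2) / (n + 1))).hasDerivAt
        exact HasDerivAt.comp (h₂ := ⇑f) (h := fun s => Real.log s / ((n : ℝ) + 1)) (‖x‖ ^ 2) hd ((Real.hasDerivAt_log hs).div_const _)
      rw [e, partialD_radial (h := fun s => f (Real.log s / (n + 1))) h1, abs_mul, abs_mul, abs_mul,
        abs_two]
      have hk := hK (Real.log (‖x‖ ^ 2) / (n + 1))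
      rw [Real.norm_eq_abs] at hk
      have hx2 := abs_coord_le x j
      have hn : (0 : ℝ) < n + 1 := by positivity
      have hxp := norm_pos_iff.2 hx
      have : |(‖x‖ ^ 2)⁻¹ / ((n : ℝ) + 1)| = (‖x‖ ^ 2)⁻¹ / ((n : ℝ) + 1) := abs_of_pos (by positivity)
      rw [this]
      calc ‖x‖ * (|deriv f (Real.log (‖x‖ ^ 2) / (n + 1))| * ((‖x‖ ^ 2)⁻¹ / (n + 1)) * (2 * |x j|))
          ≤ ‖x‖ * (K * ((‖x‖ ^ 2)⁻¹ / (n + 1)) * (2 * ‖x‖)) := by gcongr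
        _ = 2 * K * (1 / ((n : ℝ) + 1)) := by field_simp
  refine ⟨g, fun n => Real.exp (n + 1), fun n => 2 * K * (1 / ((n : ℝ) + 1)), hgc, hg0, ?_, ?_,
    fun n => (Real.exp_pos _).le, fun n => by positivity, ?_, hgd, ?_, ?_⟩
  · intro n x
    simp only [g]
    split_ifs
    · exact le_rfl
    · exact f.nonneg
  · intro n x
    simp only [g]
    split_ifs
    · exact zero_le_one
    · exact f.le_one
  · intro n x
    by_cases hx : x = 0
    · subst hx
      simp
      positivity
    · by_cases hle : ‖x‖ ≤ Real.exp (n + 1)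
      · have : |g n x| ≤ 1 := by
          simp only [g, if_neg hx]
          rw [abs_of_nonneg f.nonneg]
          exact f.le_one
        calc ‖x‖ * |g n x| ≤ Real.exp (n + 1) * 1 := by gcongr
          _ = _ := mul_one _
      · have hl : (n : ℝ) + 1 < Real.log ‖x‖ :=
          (Real.lt_log_iff_exp_lt (norm_pos_iff.2 hx)).2 (not_le.1 hle)
        have : g n x = 0 := by
          simp only [g, if_neg hx]
          apply hf0
          have hn : (0 : ℝ) < n + 1 := by positivity
          rw [Real.log_pow, abs_div, abs_of_pos hn, le_div_iff₀ hn]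
          push_cast
          linarith [le_abs_self (2 * Real.log ‖x‖)]
        rw [this]
        simp
        positivity
  · have := (tendsto_one_div_add_atTop_nhds_zero_nat (𝕜 := ℝ)).const_mul (2 * K)
    rwa [mul_zero] at this
  · intro x hx
    obtain ⟨n₀, hn₀⟩ := exists_nat_ge |Real.log (‖x‖ ^ 2)|
    filter_upwards [eventually_ge_atTop n₀] with n hn
    simp only [g, if_neg hx]
    apply f.one_of_mem_closedBall
    have hn1 : (0 : ℝ) < n + 1 := by positivity
    have hn2 : (n₀ : ℝ) ≤ n := by exact_mod_cast hn
    rw [mem_closedBall_zero_iff, Real.norm_eq_abs, abs_div, abs_of_pos hn1]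
    show _ ≤ (1 : ℝ)
    rw [div_le_one hn1]
    linarith

/-- A diagonal criterion for convergence to zero. -/
theorem tendsto_zero_of_le_add_mul {v e A B : ℕ → ℝ} (hv : ∀ n, 0 ≤ v n)
    (h : ∀ k n, v n ≤ A k + B k * e n) (hA : Tendsto A atTop (𝓝 0)) (he : Tendsto e atTop (𝓝 0)) :
    Tendsto v atTop (𝓝 0) := by
  rw [Metric.tendsto_atTop]
  intro ε hε
  obtain ⟨k, hk⟩ := (hA.eventually (gt_mem_nhds (half_pos hε))).exists
  have h2 := he.const_mul (B k)
  rw [mul_zero] at h2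
  obtain ⟨n₀, hn₀⟩ := eventually_atTop.1 (h2.eventually (gt_mem_nhds (half_pos hε)))
  refine ⟨n₀, fun n hn => ?_⟩
  rw [Real.dist_eq, sub_zero, abs_of_nonneg (hv n)]
  linarith [h k n, hn₀ n hn]

theorem tendsto_l2norm_cutoff {d : ℕ} (hd : 3 ≤ d) {g : ℕ → RSpace d → ℝ}
    (hgc : ∀ n, Continuous (g n)) (hg0 : ∀ n x, 0 ≤ g n x) (hg1 : ∀ n x, g n x ≤ 1)
    (hlim : ∀ x, x ≠ 0 → ∀ᶠ n in atTop, g n x = 1) {ψ : RSpace d → Spinor d}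
    (hψ : MemLp ψ 2 volume) :
    Tendsto (fun n => l2norm (fun x => (1 - g n x) • ψ x)) atTop (𝓝 0) := by
  have hb : ∀ n x, |1 - g n x| ≤ 1 := fun n x => by
    rw [abs_le]
    constructor <;> linarith [hg0 n x, hg1 n x]
  have hm : ∀ n, MemLp (fun x => (1 - g n x) • ψ x) 2 volume := fun n =>
    (memLp_bounded_smul (continuous_const.sub (hgc n)) zero_le_one (hb n) hψ).1
  have h1 : Tendsto (fun n => ∫ x, ‖(1 - g n x) • ψ x‖ ^ 2) atTop
      (𝓝 (∫ _ : RSpace d, (0 : ℝ))) := by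
    refine tendsto_integral_of_dominated_convergence (fun x => ‖ψ x‖ ^ 2)
      (fun n => (hm n).1.norm.pow 2) hψ.norm.integrable_sq (fun n => ?_) ?_
    · refine Eventually.of_forall fun x => ?_
      rw [Real.norm_eq_abs, abs_of_nonneg (by positivity), norm_smul, Real.norm_eq_abs]
      gcongr
      exact mul_le_of_le_one_left (norm_nonneg _) (hb n x)
    · filter_upwards [ae_ne_zero hd] with x hx
      refine tendsto_const_nhds.congr' ?_
      filter_upwards [hlim x hx] with n hn
      simp [hn]
  rw [integral_zero] at h1
  have h2 := (Real.continuous_sqrt.tendsto _).comp h1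
  rw [Real.sqrt_zero] at h2
  refine h2.congr fun n => ?_
  rw [Function.comp_apply, ← l2norm_sq (hm n), Real.sqrt_sq (l2norm_nonneg _)]

/-- The virial bound is split into a part that depends on the cutoff alone and a multiple of `D +
T`. In the application `D` is the `L²` distance to the limit, `T` the residual, and `Ψ` the mass of
the limit function missed by the cutoff. -/
theorem virial_bound_mono {c G D N B l L T δ R Ψ : ℝ} (hc : 0 ≤ c) (hD : 0 ≤ D) (hN : 0 ≤ N)
    (hl : 0 ≤ l) (hT : 0 ≤ T) (hδ : 0 ≤ δ) (hR : 0 ≤ R) (hΨ : 0 ≤ Ψ) (hG : G ≤ D + Ψ)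
    (hNB : N ≤ B) (hlL : l ≤ L) :
    2 * G * N + 2 * T * (c * R * N + (c + c * δ) / 2 * l) + c ^ 2 * δ * N * l ≤
      2 * Ψ * B + c ^ 2 * δ * B * L
        + (2 * B + 2 * (c * R * B + (c + c * δ) / 2 * L)) * (D + T) := by
  have hB := hN.trans hNB
  have hL := hl.trans hlL
  have e1 : 2 * G * N ≤ 2 * (D + Ψ) * B := by
    calc 2 * G * N ≤ 2 * (D + Ψ) * N := by gcongr
      _ ≤ _ := by gcongr
  have e2 : 2 * T * (c * R * N + (c + c * δ) / 2 * l) ≤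
      2 * T * (c * R * B + (c + c * δ) / 2 * L) := by gcongr
  have e3 : c ^ 2 * δ * N * l ≤ c ^ 2 * δ * B * L := by gcongr
  have e4 : 0 ≤ 2 * D * (c * R * B + (c + c * δ) / 2 * L) := by positivity
  have e5 : 0 ≤ 2 * T * B := by positivity
  linarith

section Limit

variable {d : ℕ} {a : Fin d → Spinor d →L[ℂ] Spinor d}
    {b : Spinor d →L[ℂ] Spinor d} {W : RSpace d → Spinor d →L[ℂ] Spinor d} {C₁ C₃ : ℝ}
    {φ : ℕ → RSpace d → Spinor d} {ψ : RSpace d → Spinor d}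

/-- The virial theorem: the dilation commutator has vanishing expectation in the limit. -/
theorem IsDecayingDirac.tendsto_virial
    (h : IsDecayingDirac a b W C₁ C₃) (hd : 3 ≤ d) (hC : 0 ≤ C₁)
    (ht : 2 * C₁ / ((d : ℝ) - 2) ≤ 1) (m E : ℝ) (hφ : ∀ n, IsTestFunction (φ n))
    (hψ : MemLp ψ 2 volume) (hlim : Tendsto (fun n => l2norm (fun x => φ n x - ψ x)) atTop (𝓝 0))
    (hT : Tendsto (fun n => l2norm (shiftedDirac a b W m E (φ n))) atTop (𝓝 0)) {B L : ℝ}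
    (hB : ∀ n, l2norm (kinetic a (φ n)) ≤ B) (hL : ∀ n, l2norm (φ n) ≤ L) :
    Tendsto (fun n => |∫ x, (inner ℂ (φ n x) (dilationCommutator a W (φ n) x)).re|) atTop
      (𝓝 0) := by
  have hdm : ∀ n, MemLp (fun x => φ n x - ψ x) 2 volume := fun n => (hφ n).memLp.sub hψ
  obtain ⟨g, R, δ, hgc, hgz, hg0, hg1, hR0, hδ0, hgR, hgδ, hδ, hg⟩ := exists_dilation_cutoff d
  have hgabs : ∀ n x, |g n x| ≤ 1 := fun n x => abs_le.2 ⟨by linarith [hg0 n x], hg1 n x⟩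
  have hA0 : Tendsto (fun k => 2 * l2norm (fun x => (1 - g k x) • ψ x) * B
      + (d : ℝ) ^ 2 * δ k * B * L) atTop (𝓝 0) := by
    have h1 := ((tendsto_l2norm_cutoff hd (fun n => (hgc n).continuous) hg0 hg1 hg hψ).const_mul
      2).mul_const B
    have h2 := (((hδ.const_mul ((d : ℝ) ^ 2)).mul_const B).mul_const L)
    have h3 := h1.add h2
    simpa using h3
  -- For fixed `k` the large factor containing `R k` multiplies a quantity tending to zero in `n`;
  -- only afterwards is `k` sent to infinity.
  refine tendsto_zero_of_le_add_mul
    (B := fun k => 2 * B + 2 * (d * R k * B + (d + d * δ k) / 2 * L)) (fun n => abs_nonneg _)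
    (fun k n => ?_) hA0 (by simpa using hlim.add hT)
  have h1 := h.virial_le hd hC ht (hφ n) m E (hgc k) (hgz k) (hgabs k) (hR0 k) (hδ0 k)
    (hgR k) (hgδ k)
  have hb : ∀ x, |1 - g k x| ≤ 1 := fun x => by
    rw [abs_le]
    constructor <;> linarith [hg0 k x, hg1 k x]
  have c1 : Continuous fun x => 1 - g k x := continuous_const.sub (hgc k).continuous
  have h2 : l2norm (fun x => (1 - g k x) • φ n x) ≤
      l2norm (fun x => φ n x - ψ x) + l2norm (fun x => (1 - g k x) • ψ x) := by
    have s1 := memLp_bounded_smul c1 zero_le_one hb (hdm n)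
    have s2 := l2norm_add_le s1.1 (memLp_bounded_smul c1 zero_le_one hb hψ).1
    simp only [← smul_add, sub_add_cancel, one_mul] at s2 s1
    exact s2.trans (add_le_add s1.2 le_rfl)
  exact h1.trans (virial_bound_mono (Nat.cast_nonneg d) (l2norm_nonneg _) (l2norm_nonneg _)
    (l2norm_nonneg _) (l2norm_nonneg _) (hδ0 k) (hR0 k) (l2norm_nonneg _) h2 (hB n) (hL n))

/-- By Hardy's inequality, an `L²` limit of test functions with vanishing kinetic energy is zero. -/
theorem IsDecayingDirac.eq_zero_of_tendsto_kinetic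
    (h : IsDecayingDirac a b W C₁ C₃) (hd : 3 ≤ d) (hφ : ∀ n, IsTestFunction (φ n))
    (hψ : MemLp ψ 2 volume) (hlim : Tendsto (fun n => l2norm (fun x => φ n x - ψ x)) atTop (𝓝 0))
    (hNlim : Tendsto (fun n => l2norm (kinetic a (φ n))) atTop (𝓝 0)) :
    ψ =ᵐ[volume] 0 := by
  have hφm := fun n => (hφ n).memLp
  have hdm : ∀ n, MemLp (fun x => φ n x - ψ x) 2 volume := fun n => (hφm n).sub hψ
  -- The weight `(1 + |x|)⁻¹` is bounded, hence compatible with `L²` convergence, and lies below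
  -- `|x|⁻¹`, hence is controlled by Hardy.
  have hq : Continuous fun x : RSpace d => (1 + ‖x‖)⁻¹ :=
    (by fun_prop : Continuous fun x : RSpace d => 1 + ‖x‖).inv₀ fun x => by positivity
  have hq1 : ∀ x : RSpace d, |(1 + ‖x‖)⁻¹| ≤ 1 := fun x => by
    rw [abs_of_pos (by positivity)]
    exact inv_le_one_of_one_le₀ (by linarith [norm_nonneg x])
  have hqψ := (memLp_bounded_smul hq zero_le_one hq1 hψ).1
  have hz : l2norm (fun x => (1 + ‖x‖)⁻¹ • ψ x) = 0 := by
    refine le_antisymm ?_ (l2norm_nonneg _)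
    have hle : ∀ n, l2norm (fun x => (1 + ‖x‖)⁻¹ • ψ x) ≤ 2 / ((d : ℝ) - 2) * l2norm (kinetic a (φ n)) + l2norm (fun x => φ n x - ψ x) := by
      intro n
      obtain ⟨s1, s2⟩ := h.hardy hd (hφ n)
      have s3 := memLp_bounded_smul hq zero_le_one hq1 (hφm n)
      have s4 := memLp_bounded_smul hq zero_le_one hq1 (hdm n)
      have s5 := l2norm_sub_le s3.1 s4.1
      simp only [← smul_sub, sub_sub_cancel] at s5
      have s6 : l2norm (fun x => (1 + ‖x‖)⁻¹ • φ n x) ≤ 1 * l2norm (fun x => ‖x‖⁻¹ • φ n x) := by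
        refine l2norm_le_mul_of_ae s1 zero_le_one ?_
        filter_upwards [ae_ne_zero hd] with x hx
        rw [norm_smul, norm_smul, one_mul, Real.norm_eq_abs, Real.norm_eq_abs,
          abs_of_pos (by positivity), abs_of_nonneg (by positivity)]
        have := norm_pos_iff.2 hx
        gcongr
        linarith
      have s7 := s4.2
      rw [one_mul] at s6 s7
      exact s5.trans (add_le_add (s6.trans s2) s7)
    have hl : Tendsto (fun n => 2 / ((d : ℝ) - 2) * l2norm (kinetic a (φ n)) + l2norm (fun x => φ n x - ψ x)) atTop (𝓝 0) := by
      simpa using (hNlim.const_mul (2 / ((d : ℝ) - 2))).add hlim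
    exact ge_of_tendsto' hl hle
  have hz2 : eLpNorm (fun x => (1 + ‖x‖)⁻¹ • ψ x) 2 volume = 0 :=
    ((ENNReal.toReal_eq_zero_iff _).1 hz).resolve_right hqψ.2.ne
  rw [eLpNorm_eq_zero_iff hqψ.1 (by simp)] at hz2
  filter_upwards [hz2] with x hx
  exact (smul_eq_zero.1 hx).resolve_left (by positivity)

/-- An `L²` limit of test functions along which `-i ∑ a_j ∂_j + m b + W - E` tends to zero
vanishes. -/
theorem IsDecayingDirac.eq_zero_of_tendsto
    (h : IsDecayingDirac a b W C₁ C₃) (hd : 3 ≤ d) (hC : 0 ≤ C₁) (hC₃ : 0 ≤ C₃) {m : ℝ}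
    (hm : 0 ≤ m) (hsmall : 4 * C₁ / ((d : ℝ) - 2) + 2 * m * C₃ / ((d : ℝ) - 2) ^ 2 < 1) (E : ℝ)
    (hφ : ∀ n, IsTestFunction (φ n))
    (hψ : MemLp ψ 2 volume) (hlim : Tendsto (fun n => l2norm (fun x => φ n x - ψ x)) atTop (𝓝 0))
    (hT : Tendsto (fun n => l2norm (shiftedDirac a b W m E (φ n))) atTop (𝓝 0)) :
    ψ =ᵐ[volume] 0 := by
  have hd' : (0 : ℝ) < (d : ℝ) - 2 := by
    have : (3 : ℝ) ≤ d := by exact_mod_cast hd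
    linarith
  have hμ : 0 ≤ 2 * m * C₃ / ((d : ℝ) - 2) ^ 2 := by positivity
  have h42 : 4 * C₁ / ((d : ℝ) - 2) = 2 * (2 * C₁ / ((d : ℝ) - 2)) := by ring
  have ht : 2 * C₁ / ((d : ℝ) - 2) ≤ 1 / 2 := by linarith
  have hφm := fun n => (hφ n).memLp
  have hdm : ∀ n, MemLp (fun x => φ n x - ψ x) 2 volume := fun n => (hφm n).sub hψ
  set N : ℕ → ℝ := fun n => l2norm (kinetic a (φ n)) with hN
  set T : ℕ → ℝ := fun n => l2norm (shiftedDirac a b W m E (φ n)) with hTdef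
  set D : ℕ → ℝ := fun n => l2norm (fun x => φ n x - ψ x) with hD
  have hN0 : ∀ n, 0 ≤ N n := fun n => l2norm_nonneg _
  have hT0 : ∀ n, 0 ≤ T n := fun n => l2norm_nonneg _
  have hD0 : ∀ n, 0 ≤ D n := fun n => l2norm_nonneg _
  obtain ⟨KD, hKD⟩ := hlim.bddAbove_range
  obtain ⟨KT, hKT⟩ := hT.bddAbove_range
  replace hKD : ∀ n, D n ≤ KD := fun n => hKD ⟨n, rfl⟩
  replace hKT : ∀ n, T n ≤ KT := fun n => hKT ⟨n, rfl⟩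
  obtain ⟨L, hL0, hL⟩ : ∃ L, 0 ≤ L ∧ ∀ n, l2norm (φ n) ≤ L := by
    refine ⟨KD + l2norm ψ, add_nonneg ((hD0 0).trans (hKD 0)) (l2norm_nonneg _), fun n => ?_⟩
    have h1 := l2norm_add_le (hdm n) hψ
    simp only [sub_add_cancel] at h1
    exact h1.trans (add_le_add (hKD n) le_rfl)
  -- The smallness condition gives `2C₁/(d-2) ≤ 1/2`, so the a priori estimate bounds the kinetic
  -- norms uniformly, with a factor 2.
  obtain ⟨B, hB0, hB⟩ : ∃ B, 0 ≤ B ∧ ∀ n, N n ≤ B := by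
    have h0 : ∀ n, N n ≤ 2 * (KT + (|m| * ‖b‖ + |E|) * L) := by
      intro n
      have h1 := h.kinetic_le hd hC (hφ n) m E
      have h2 : (|m| * ‖b‖ + |E|) * l2norm (φ n) ≤ (|m| * ‖b‖ + |E|) * L := by
        gcongr
        exact hL n
      have h3 : (1 / 2) * N n ≤ (1 - 2 * C₁ / ((d : ℝ) - 2)) * N n :=
        mul_le_mul_of_nonneg_right (by linarith) (hN0 n)
      have h4 := hKT n
      simp only [hN, hTdef] at *
      linarith
    exact ⟨_, (hN0 0).trans (h0 0), h0⟩
  set v : ℕ → ℝ := fun n => |∫ x, (inner ℂ (φ n x) (dilationCommutator a W (φ n) x)).re| with hv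
  have hv0 : Tendsto v atTop (𝓝 0) :=
    h.tendsto_virial hd hC (by linarith) m E hφ hψ hlim hT hB hL
  set c : ℝ := 1 - 4 * C₁ / ((d : ℝ) - 2) - 2 * m * C₃ / ((d : ℝ) - 2) ^ 2 with hc
  have hc0 : 0 < c := by linarith
  have hNlim : Tendsto N atTop (𝓝 0) := by
    have h1 : Tendsto (fun n => c⁻¹ * (|E| * v n + 2 * T n * B)) atTop (𝓝 0) := by
      have := (((hv0.const_mul |E|).add ((hT.const_mul 2).mul_const B)).const_mul c⁻¹)
      simpa using this
    have h2 : Tendsto (fun n => N n ^ 2) atTop (𝓝 0) := by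
      refine squeeze_zero (fun n => sq_nonneg _) (fun n => ?_) h1
      have h3 := h.kinetic_sq_le hd hC hC₃ ht (hφ n) hm E
      have h4 : 2 * T n * N n ≤ 2 * T n * B := by
        have := hT0 n
        gcongr
        exact hB n
      rw [← div_eq_inv_mul, le_div_iff₀ hc0, mul_comm]
      exact h3.trans (add_le_add le_rfl h4)
    have h3 := (Real.continuous_sqrt.tendsto _).comp h2
    rw [Real.sqrt_zero] at h3
    exact h3.congr fun n => Real.sqrt_sq (hN0 n)
  exact h.eq_zero_of_tendsto_kinetic hd hφ hψ hlim hNlim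

end Limit

/-! ### Irreducibility of the Dirac matrices -/

/-- A nonzero space carrying `2n` anticommuting involutions has dimension at least `2^n`. -/
theorem two_pow_le_finrank_of_anticommute {E : Type*} [AddCommGroup E] [Module ℂ E]
    [FiniteDimensional ℂ E] (γ : ℕ → E →ₗ[ℂ] E) (n : ℕ)
    (hsq : ∀ i < 2 * n, ∀ u, γ i (γ i u) = u)
    (hanti : ∀ i < 2 * n, ∀ j < 2 * n, i ≠ j → ∀ u, γ i (γ j u) = -γ j (γ i u))
    (U : Submodule ℂ E) (hU : U ≠ ⊥) (hinv : ∀ i < 2 * n, ∀ u ∈ U, γ i u ∈ U) :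
    2 ^ n ≤ Module.finrank ℂ U := by
  induction n generalizing U with
  | zero => simpa using Submodule.one_le_finrank_iff.2 hU
  | succ n ih =>
    set p := γ (2 * n) with hp
    set q := γ (2 * n + 1) with hq
    have hpq : ∀ u, p (q u) = -q (p u) := hanti _ (by omega) _ (by omega) (by omega)
    have hpp : ∀ u, p (p u) = u := hsq _ (by omega)
    have hqq : ∀ u, q (q u) = u := hsq _ (by omega)
    -- The product `i p q` is an involution that commutes with the first `2n` generators and
    -- anticommutes with `p`. Its two eigenspaces in `U` are thus invariant under those generators
    -- and exchanged by `p`, so the dimension at least doubles.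
    set τ : E →ₗ[ℂ] E := Complex.I • (p ∘ₗ q) with hτ
    have hτa : ∀ u, τ u = Complex.I • p (q u) := fun u => rfl
    have hττ : ∀ u, τ (τ u) = u := by
      intro u
      simp only [hτa, map_smul, smul_smul, Complex.I_mul_I]
      rw [hpq (p (q u)), hpp, hqq]
      simp
    have hτU : ∀ u ∈ U, τ u ∈ U := fun u hu =>
      U.smul_mem _ (hinv _ (by omega) _ (hinv _ (by omega) _ hu))
    have hpτ : ∀ u, τ (p u) = -p (τ u) := by
      intro u
      simp only [hτa, map_smul]
      rw [eq_neg_of_add_eq_zero_left (b := p (q u)) (a := q (p u)) (by rw [hpq]; simp)]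
      simp
    have hcomm : ∀ i < 2 * n, ∀ u, γ i (τ u) = τ (γ i u) := by
      intro i hi u
      simp only [hτa, map_smul]
      rw [hanti i (by omega) (2 * n) (by omega) (by omega),
        hanti i (by omega) (2 * n + 1) (by omega) (by omega)]
      simp [hp, hq]
    set P : Submodule ℂ E := U ⊓ LinearMap.eqLocus τ LinearMap.id with hP
    set Q : Submodule ℂ E := U ⊓ LinearMap.eqLocus τ (-LinearMap.id) with hQ
    have memP : ∀ u, u ∈ P ↔ u ∈ U ∧ τ u = u := fun u => Iff.rfl
    have memQ : ∀ u, u ∈ Q ↔ u ∈ U ∧ τ u = -u := fun u => Iff.rfl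
    have hdisj : P ⊓ Q = ⊥ := by
      rw [eq_bot_iff]
      rintro u ⟨h1, h2⟩
      have e : u = -u := ((memP u).1 h1).2.symm.trans ((memQ u).1 h2).2
      have e2 : (2 : ℂ) • u = 0 := by
        rw [two_smul]
        exact add_eq_zero_iff_eq_neg.2 e
      exact (smul_eq_zero.1 e2).resolve_left two_ne_zero
    have hPQ : ∀ u ∈ P, p u ∈ Q := fun u hu => (memQ _).2
      ⟨hinv _ (by omega) _ hu.1, by rw [hpτ, ((memP u).1 hu).2]⟩
    have hQP : ∀ u ∈ Q, p u ∈ P := fun u hu => (memP _).2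
      ⟨hinv _ (by omega) _ hu.1, by rw [hpτ, ((memQ u).1 hu).2]; simp⟩
    have hp0 : ∀ u, p u = 0 → u = 0 := fun u hu => by rw [← hpp u, hu, map_zero]
    obtain ⟨u, huU, hu0⟩ := (Submodule.ne_bot_iff U).1 hU
    have hPne : P ≠ ⊥ := by
      rw [Submodule.ne_bot_iff]
      -- Either the projection of `u` to `P` is nonzero, or `u` lies in `Q` and `p` carries it into
      -- `P`.
      by_cases hc : u + τ u = 0
      · refine ⟨p u, hQP u ((memQ u).2 ⟨huU, ?_⟩), fun h0 => hu0 (hp0 u h0)⟩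
        exact eq_neg_of_add_eq_zero_right hc
      · exact ⟨u + τ u, (memP _).2 ⟨U.add_mem huU (hτU u huU), by
          rw [map_add, hττ, add_comm]⟩, hc⟩
    have hQne : Q ≠ ⊥ := by
      obtain ⟨w, hw, hw0⟩ := (Submodule.ne_bot_iff P).1 hPne
      exact (Submodule.ne_bot_iff Q).2 ⟨p w, hPQ w hw, fun h0 => hw0 (hp0 w h0)⟩
    have hP2 := ih (fun i hi => hsq i (by omega)) (fun i hi j hj => hanti i (by omega) j (by omega))
      P hPne fun i hi w hw => (memP _).2
        ⟨hinv i (by omega) w hw.1, by rw [← hcomm i hi, ((memP w).1 hw).2]⟩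
    have hQ2 := ih (fun i hi => hsq i (by omega)) (fun i hi j hj => hanti i (by omega) j (by omega))
      Q hQne fun i hi w hw => (memQ _).2
        ⟨hinv i (by omega) w hw.1, by rw [← hcomm i hi, ((memQ w).1 hw).2, map_neg]⟩
    have hsum := Submodule.finrank_sup_add_finrank_inf_eq P Q
    rw [hdisj, finrank_bot, add_zero] at hsum
    have hle : Module.finrank ℂ (P ⊔ Q : Submodule ℂ E) ≤ Module.finrank ℂ U :=
      Submodule.finrank_mono (sup_le inf_le_left inf_le_left)
    rw [pow_succ]
    omega

/-- Irreducibility of the Dirac matrices in dimension `2^⌊(d+1)/2⌋`. -/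
theorem eq_smul_of_commute_clifford {d : ℕ} (a : Fin d → Spinor d →L[ℂ] Spinor d)
    (b : Spinor d →L[ℂ] Spinor d)
    (haa : ∀ j k u, a j (a k u) + a k (a j u) = if j = k then (2 : ℂ) • u else 0)
    (hab : ∀ j u, a j (b u) + b (a j u) = 0) (hbb : ∀ u, b (b u) = u)
    (A : Spinor d →L[ℂ] Spinor d) (hAa : ∀ j u, A (a j u) = a j (A u))
    (hAb : ∀ u, A (b u) = b (A u)) : ∃ c : ℂ, ∀ u, A u = c • u := by
  have hfr : Module.finrank ℂ (Spinor d) = 2 ^ ((d + 1) / 2) := by simp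
  have : Nontrivial (Spinor d) :=
    Module.nontrivial_of_finrank_pos (R := ℂ) (by rw [hfr]; positivity)
  -- An eigenspace of `A` is invariant under all the generators, so the dimension bound forces it to
  -- be the whole space.
  obtain ⟨c, hc⟩ := Module.End.exists_eigenvalue (A : Spinor d →ₗ[ℂ] Spinor d)
  refine ⟨c, fun u => ?_⟩
  set U := Module.End.eigenspace (A : Spinor d →ₗ[ℂ] Spinor d) c with hUdef
  have memU : ∀ u, u ∈ U ↔ A u = c • u := fun u => Module.End.mem_eigenspace_iff
  -- Only indices below `2⌊(d+1)/2⌋ ≤ d + 1` matter. For even `d` they give just the `a_j`; for odd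
  -- `d` the index `d` adds `b`, once.
  let γ : ℕ → Spinor d →ₗ[ℂ] Spinor d := fun i =>
    if hi : i < d then (a ⟨i, hi⟩ : Spinor d →ₗ[ℂ] Spinor d) else b
  have hγa : ∀ i (hi : i < d) u, γ i u = a ⟨i, hi⟩ u := fun i hi u => by simp [γ, hi]
  have hγb : ∀ i (_ : ¬ i < d) u, γ i u = b u := fun i hi u => by simp [γ, hi]
  have hsq : ∀ i u, γ i (γ i u) = u := by
    intro i u
    by_cases hi : i < d
    · rw [hγa i hi, hγa i hi]
      have h := haa ⟨i, hi⟩ ⟨i, hi⟩ u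
      rw [if_pos rfl, ← two_smul ℂ] at h
      exact smul_right_injective _ (two_ne_zero' ℂ) h
    · rw [hγb i hi, hγb i hi, hbb]
  have hanti : ∀ i < 2 * ((d + 1) / 2), ∀ j < 2 * ((d + 1) / 2), i ≠ j →
      ∀ u, γ i (γ j u) = -γ j (γ i u) := by
    intro i hi j hj hij u
    apply eq_neg_of_add_eq_zero_left
    by_cases h1 : i < d <;> by_cases h2 : j < d
    · rw [hγa i h1, hγa j h2, hγa j h2, hγa i h1, haa, if_neg]
      simpa using hij
    · rw [hγa i h1, hγb j h2, hγb j h2, hγa i h1, hab]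
    · rw [hγb i h1, hγa j h2, hγa j h2, hγb i h1, add_comm, hab]
    · omega
  have hle := two_pow_le_finrank_of_anticommute γ _ (fun i _ => hsq i) hanti U hc (by
    intro i _ w hw
    rw [memU] at hw ⊢
    by_cases hi : i < d
    · rw [hγa i hi, hAa, hw, map_smul]
    · rw [hγb i hi, hAb, hw, map_smul])
  have htop : U = ⊤ := Submodule.eq_top_of_finrank_eq
    (le_antisymm (Submodule.finrank_le U) (by rw [hfr]; exact hle))
  exact (memU u).1 (htop ▸ Submodule.mem_top)

/-! ### The limit of the potential at infinity -/

section Limit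

variable {d : ℕ} {F : Type*} [NormedAddCommGroup F] [NormedSpace ℝ F] {B : RSpace d → F} {C : ℝ}

/-- Along the ray `t • x` the derivative is at most `C/(t|x|)² · |x| = (C/|x|) t⁻²`, which is
integrated from `r` to `s`. -/
theorem norm_sub_ray_le (hB : ∀ x, x ≠ 0 → DifferentiableAt ℝ B x)
    (hC : ∀ x, x ≠ 0 → ‖fderiv ℝ B x‖ ≤ C / ‖x‖ ^ 2) {x : RSpace d} (hx : x ≠ 0) {r s : ℝ}
    (hr : 0 < r) (hrs : r ≤ s) : ‖B (s • x) - B (r • x)‖ ≤ C / ‖x‖ * (r⁻¹ - s⁻¹) := by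
  have hxp := norm_pos_iff.2 hx
  have hne : ∀ t, r ≤ t → t • x ≠ 0 := fun t ht => smul_ne_zero (hr.trans_le ht).ne' hx
  have hd : ∀ t, r ≤ t → HasDerivAt (fun t : ℝ => B (t • x) - B (r • x))
      (fderiv ℝ B (t • x) x) t := by
    intro t ht
    have h1 : HasDerivAt (fun t : ℝ => t • x) x t := by
      simpa using (hasDerivAt_id t).smul_const x
    exact ((hB _ (hne t ht)).hasFDerivAt.comp_hasDerivAt t h1).sub_const _
  have hb : ∀ t, r ≤ t → HasDerivAt (fun t : ℝ => C / ‖x‖ * (r⁻¹ - t⁻¹))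
      (C / ‖x‖ * (t ^ 2)⁻¹) t := by
    intro t ht
    have := ((hasDerivAt_inv (hr.trans_le ht).ne').const_sub r⁻¹).const_mul (C / ‖x‖)
    simpa using this
  refine image_norm_le_of_norm_deriv_right_le_deriv_boundary' (a := r) (b := s)
    (f := fun t : ℝ => B (t • x) - B (r • x)) (f' := fun t => fderiv ℝ B (t • x) x)
    (B := fun t : ℝ => C / ‖x‖ * (r⁻¹ - t⁻¹)) (B' := fun t => C / ‖x‖ * (t ^ 2)⁻¹)
    (fun t ht => (hd t ht.1).continuousAt.continuousWithinAt)
    (fun t ht => (hd t ht.1).hasDerivWithinAt) (by simp)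
    (fun t ht => (hb t ht.1).continuousAt.continuousWithinAt)
    (fun t ht => (hb t ht.1).hasDerivWithinAt) ?_ (Set.right_mem_Icc.2 hrs)
  intro t ht
  have htp : 0 < t := hr.trans_le ht.1
  refine ((fderiv ℝ B (t • x)).le_opNorm x).trans ?_
  have h1 := mul_le_mul_of_nonneg_right (hC _ (hne t ht.1)) hxp.le
  refine h1.trans (le_of_eq ?_)
  rw [norm_smul, Real.norm_eq_abs, abs_of_pos htp]
  field_simp

/-- A function off the origin whose gradient is `O(|x|⁻²)` has a limit at infinity. -/
theorem exists_limit_at_infinity [CompleteSpace F] (hd : 2 ≤ d) (hC0 : 0 ≤ C)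
    (hB : ∀ x, x ≠ 0 → DifferentiableAt ℝ B x)
    (hC : ∀ x, x ≠ 0 → ‖fderiv ℝ B x‖ ≤ C / ‖x‖ ^ 2) :
    ∃ L : F, ∀ x, x ≠ 0 → ‖B x - L‖ ≤ C / ‖x‖ := by
  have hn1 : ∀ n : ℕ, (0 : ℝ) < (n : ℝ) + 1 := fun n => by positivity
  have hray : ∀ x : RSpace d, ∃ l, x ≠ 0 →
      Tendsto (fun n : ℕ => B (((n : ℝ) + 1) • x)) atTop (𝓝 l) := by
    intro x
    by_cases hx : x = 0
    · exact ⟨0, fun h => (h hx).elim⟩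
    have hcs : CauchySeq fun n : ℕ => B (((n : ℝ) + 1) • x) := by
      refine cauchySeq_of_le_tendsto_0' (fun n : ℕ => C / ‖x‖ * (1 / ((n : ℝ) + 1))) ?_ ?_
      · intro n k hnk
        rw [dist_comm, dist_eq_norm]
        refine (norm_sub_ray_le hB hC hx (hn1 n) (by gcongr)).trans ?_
        have := hn1 k
        have h0 : 0 ≤ C / ‖x‖ := by positivity
        gcongr
        rw [one_div]
        linarith [inv_nonneg.2 this.le]
      · simpa using (tendsto_one_div_add_atTop_nhds_zero_nat (𝕜 := ℝ)).const_mul (C / ‖x‖)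
    obtain ⟨l, hl⟩ := cauchySeq_tendsto_of_complete hcs
    exact ⟨l, fun _ => hl⟩
  choose l hl using hray
  have hlb : ∀ x, x ≠ 0 → ‖B x - l x‖ ≤ C / ‖x‖ := by
    intro x hx
    have h1 : Tendsto (fun n : ℕ => ‖B (((n : ℝ) + 1) • x) - B x‖) atTop (𝓝 ‖l x - B x‖) :=
      ((hl x hx).sub_const _).norm
    rw [norm_sub_rev]
    refine le_of_tendsto' h1 fun n => ?_
    have h2 := norm_sub_ray_le hB hC hx one_pos (s := (n : ℝ) + 1) (by simp)
    rw [one_smul] at h2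
    refine h2.trans (mul_le_of_le_one_right (by positivity) ?_)
    have := inv_nonneg.2 (hn1 n).le
    rw [inv_one]
    linarith
  -- On the ball dilated by `n+1` lengths grow like `n` and the gradient decays like `n⁻²`.
  -- Neighbouring rays therefore have the same limit, and connectedness of the punctured space makes
  -- the limit global.
  have hloc : ∀ x, x ≠ 0 → l =ᶠ[𝓝 x] fun _ => l x := by
    intro x hx
    have hxp := norm_pos_iff.2 hx
    filter_upwards [Metric.ball_mem_nhds x (half_pos hxp)] with y hy
    have hfar : ∀ z ∈ Metric.ball x (‖x‖ / 2), ‖x‖ / 2 ≤ ‖z‖ := by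
      intro z hz
      rw [mem_ball_iff_norm, norm_sub_rev] at hz
      have := norm_sub_norm_le x z
      linarith
    have hy0 : y ≠ 0 := norm_pos_iff.1 ((half_pos hxp).trans_le (hfar y hy))
    refine tendsto_nhds_unique (hl y hy0) ?_
    have hdiff : Tendsto (fun n : ℕ => B (((n : ℝ) + 1) • y) - B (((n : ℝ) + 1) • x)) atTop
        (𝓝 0) := by
      refine squeeze_zero_norm (a := fun n : ℕ => C / (‖x‖ / 2) ^ 2 * ‖y - x‖ * (1 / ((n : ℝ) + 1)))
        (fun n => ?_) ?_
      · have hconv := (convex_ball x (‖x‖ / 2)).smul ((n : ℝ) + 1)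
        have hz : ∀ z ∈ ((n : ℝ) + 1) • Metric.ball x (‖x‖ / 2),
            z ≠ 0 ∧ ((n : ℝ) + 1) * (‖x‖ / 2) ≤ ‖z‖ := by
          rintro z ⟨w, hw, rfl⟩
          have hw2 := hfar w hw
          have e : ((n : ℝ) + 1) * (‖x‖ / 2) ≤ ‖((n : ℝ) + 1) • w‖ := by
            rw [norm_smul, Real.norm_eq_abs, abs_of_pos (hn1 n)]
            gcongr
          have hpos : 0 < ((n : ℝ) + 1) * (‖x‖ / 2) := by positivity
          exact ⟨norm_pos_iff.1 (hpos.trans_le e), e⟩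
        have := hconv.norm_image_sub_le_of_norm_fderiv_le (𝕜 := ℝ) (f := B)
          (C := C / (((n : ℝ) + 1) * (‖x‖ / 2)) ^ 2)
          (fun z h => hB z (hz z h).1)
          (fun z h => (hC z (hz z h).1).trans (by
            have := (hz z h).2
            gcongr))
          (Set.smul_mem_smul_set (Metric.mem_ball_self (half_pos hxp)))
          (Set.smul_mem_smul_set hy)
        refine this.trans (le_of_eq ?_)
        rw [← smul_sub, norm_smul, Real.norm_eq_abs, abs_of_pos (hn1 n)]
        field_simp
      · simpa using (tendsto_one_div_add_atTop_nhds_zero_nat (𝕜 := ℝ)).const_mul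
          (C / (‖x‖ / 2) ^ 2 * ‖y - x‖)
    simpa using hdiff.add (hl x hx)
  have hconn : IsPreconnected ({0}ᶜ : Set (RSpace d)) := by
    refine (isConnected_compl_singleton_of_one_lt_rank ?_ 0).isPreconnected
    rw [← Module.finrank_eq_rank]
    simp only [finrank_euclideanSpace, Fintype.card_fin]
    exact_mod_cast hd
  have hder : ∀ x, x ≠ 0 → HasFDerivAt l (0 : RSpace d →L[ℝ] F) x := fun x hx =>
    (hasFDerivAt_const (l x) x).congr_of_eventuallyEq (hloc x hx)
  obtain ⟨L, hL⟩ := isOpen_compl_singleton.exists_is_const_of_fderiv_eq_zero hconn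
    (fun x hx => (hder x hx).differentiableAt.differentiableWithinAt)
    (fun x hx => (hder x hx).fderiv)
  exact ⟨L, fun x hx => hL x hx ▸ hlb x hx⟩

end Limit

/-! ### From matrices to operators -/

section MatrixOperators

variable {d : ℕ}

/-- The operator on Euclidean `ℂ^N` given by a matrix. -/
noncomputable abbrev matOp (A : SpinMat d) : Spinor d →L[ℂ] Spinor d :=
  Matrix.toEuclideanCLM (n := Fin (spinorDim d)) (𝕜 := ℂ) A

theorem matOp_mul_apply (A B : SpinMat d) (u : Spinor d) : matOp (A * B) u = matOp A (matOp B u) := by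
  simp [matOp, map_mul]

theorem matOp_symm {A : SpinMat d} (hA : A.IsHermitian) (u v : Spinor d) :
    inner ℂ (matOp A u) v = inner ℂ u (matOp A v) := by
  have h : IsSelfAdjoint (matOp A) := by
    rw [isSelfAdjoint_iff, ← map_star]
    congr 1
  exact h.isSymmetric u v

/-- `matOp` as a real-linear map of the matrix entries. -/
noncomputable def matOpEntries (d : ℕ) :
    (Fin (spinorDim d) → Fin (spinorDim d) → ℂ) →L[ℝ] (Spinor d →L[ℂ] Spinor d) :=
  LinearMap.toContinuousLinearMap
    { toFun := fun A => matOp (Matrix.of A)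
      map_add' := fun A B => map_add (Matrix.toEuclideanCLM (n := Fin (spinorDim d)) (𝕜 := ℂ))
        (Matrix.of A) (Matrix.of B)
      map_smul' := fun r A => by
        have : Matrix.of (r • A) = (r : ℂ) • Matrix.of A := by
          ext i j
          simp
        rw [this]
        simp only [matOp, map_smul]
        rfl }

theorem contDiffAt_matOp {n : WithTop ℕ∞} {V : RSpace d → SpinMat d} {x : RSpace d}
    (hV : ∀ k l, ContDiffAt ℝ n (fun y => V y k l) x) : ContDiffAt ℝ n (fun y => matOp (V y)) x :=
  (matOpEntries d).contDiff.contDiffAt.comp x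
    (contDiffAt_pi.2 fun k => contDiffAt_pi.2 fun l => hV k l)

theorem partialD_matOp {V : RSpace d → SpinMat d} {x : RSpace d}
    (hV : ∀ k l, DifferentiableAt ℝ (fun y => V y k l) x) (j : Fin d) :
    partialD j (fun y => matOp (V y)) x = matOp (matPartialD j V x) := by
  have h1 : HasFDerivAt (fun y k l => V y k l) (ContinuousLinearMap.pi fun k =>
      ContinuousLinearMap.pi fun l => fderiv ℝ (fun y => V y k l) x) x :=
    hasFDerivAt_pi.2 fun k => hasFDerivAt_pi.2 fun l => (hV k l).hasFDerivAt
  have h2 : fderiv ℝ (fun y => matOp (V y)) x = _ :=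
    ((matOpEntries d).hasFDerivAt.comp x h1).fderiv
  simp only [partialD, h2]
  rfl

/-- Cauchy–Schwarz over the coordinates: `gradNorm` controls the derivative in every direction, in
particular the radial one. -/
theorem norm_fderiv_matOp_le {V : RSpace d → SpinMat d} {x : RSpace d}
    (hV : ∀ k l, DifferentiableAt ℝ (fun y => V y k l) x) :
    ‖fderiv ℝ (fun y => matOp (V y)) x‖ ≤ gradNorm V x := by
  refine ContinuousLinearMap.opNorm_le_bound _ (Real.sqrt_nonneg _) fun v => ?_
  rw [fderiv_apply_eq_sum]
  refine (norm_sum_le _ _).trans ?_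
  have h := Real.sum_mul_le_sqrt_mul_sqrt Finset.univ (fun j => |v j|)
    (fun j => matNorm (matPartialD j V x))
  have e : √(∑ j, |v j| ^ 2) = ‖v‖ := by
    rw [EuclideanSpace.norm_eq]
    simp
  rw [e, mul_comm] at h
  refine le_trans (le_of_eq ?_) h
  refine Finset.sum_congr rfl fun j _ => ?_
  rw [norm_smul, partialD_matOp hV]
  rfl

theorem matOp_eulerD {V : RSpace d → SpinMat d} {x : RSpace d}
    (hV : ∀ k l, DifferentiableAt ℝ (fun y => V y k l) x) :
    matOp (eulerD V x) = fderiv ℝ (fun y => matOp (V y)) x x := by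
  rw [fderiv_apply_eq_sum]
  simp only [eulerD, matOp, map_sum, map_smul, partialD_matOp hV]
  rfl

theorem fderiv_anticommutator {B : RSpace d → Spinor d →L[ℂ] Spinor d} {x : RSpace d}
    (hB : DifferentiableAt ℝ B x) (b : Spinor d →L[ℂ] Spinor d) (v : RSpace d) (u : Spinor d) :
    fderiv ℝ (fun y => B y ∘L b + b ∘L B y) x v u = fderiv ℝ B x v (b u) + b (fderiv ℝ B x v u) := by
  let T : (Spinor d →L[ℂ] Spinor d) →L[ℝ] (Spinor d →L[ℂ] Spinor d) :=
    LinearMap.toContinuousLinearMap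
      { toFun := fun A => A ∘L b + b ∘L A
        map_add' := fun A A' => by
          ext u
          simp
          abel
        map_smul' := fun r A => by
          ext u
          simp }
  have h : fderiv ℝ (fun y => B y ∘L b + b ∘L B y) x = _ :=
    (T.hasFDerivAt.comp x hB.hasFDerivAt).fderiv
  rw [h]
  rfl

theorem commute_of_tendsto_commutator {B : ℕ → Spinor d →L[ℂ] Spinor d}
    {L A : Spinor d →L[ℂ] Spinor d} (hB : Tendsto B atTop (𝓝 L))
    (h : Tendsto (fun n => A * B n - B n * A) atTop (𝓝 0)) (u : Spinor d) : L (A u) = A (L u) := by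
  have h1 := (hB.const_mul A).sub (hB.mul_const A)
  have h2 := sub_eq_zero.1 (tendsto_nhds_unique h1 h)
  exact (DFunLike.congr_fun h2 u).symm

theorem ofReal_re_eq_of_tendsto_symm {B : ℕ → Spinor d →L[ℂ] Spinor d}
    {L : Spinor d →L[ℂ] Spinor d} (hB : Tendsto B atTop (𝓝 L))
    (hs : ∀ n u v, inner ℂ (B n u) v = inner ℂ u (B n v)) {c : ℂ} (hc : ∀ u, L u = c • u) :
    ((c.re : ℝ) : ℂ) = c := by
  have : Nontrivial (Spinor d) := Module.nontrivial_of_finrank_pos (R := ℂ) (by simp)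
  obtain ⟨u, hu⟩ := exists_ne (0 : Spinor d)
  have h2 : Tendsto (fun n => B n u) atTop (𝓝 (L u)) :=
    (((by fun_prop : Continuous fun M : Spinor d →L[ℂ] Spinor d => M u)).tendsto L).comp hB
  have h3 : inner ℂ (L u) u = inner ℂ u (L u) :=
    tendsto_nhds_unique (h2.inner tendsto_const_nhds)
      ((tendsto_const_nhds.inner h2).congr fun n => (hs n u u).symm)
  rw [hc, inner_smul_left, inner_smul_right] at h3
  exact Complex.conj_eq_iff_re.1 (mul_right_cancel₀ (inner_self_ne_zero.2 hu) h3)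

end MatrixOperators

/-- The limit of the potential at infinity is a real scalar, and subtracting it produces a
potential with critical decay. -/
theorem exists_isDecayingDirac {d : ℕ} (hd : 3 ≤ d) {α : Fin d → SpinMat d}
    {β : SpinMat d} (hαβ : IsDiracMatrices α β) {V : RSpace d → SpinMat d}
    (hherm : ∀ x, x ≠ 0 → (V x).IsHermitian)
    (hsm : ∀ k l, ContDiffOn ℝ ∞ (fun x => V x k l) {0}ᶜ)
    {C₁ C₂ C₃ C₄ : ℝ} (hC₁ : 0 ≤ C₁)
    (hgrad : ∀ x, x ≠ 0 → gradNorm V x ≤ C₁ / ‖x‖ ^ 2)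
    (halpha : ∀ j x, x ≠ 0 → matNorm (α j * V x - V x * α j) ≤ C₂ / ‖x‖)
    (hanti : ∀ x, x ≠ 0 →
      matNorm (eulerD (fun y => V y * β + β * V y) x) ≤ C₃ / ‖x‖ ^ 2)
    (hbeta : ∀ x, x ≠ 0 → matNorm (β * V x - V x * β) ≤ C₄ / ‖x‖ ^ 2) :
    ∃ v₀ : ℝ, IsDecayingDirac (fun j => matOp (α j)) (matOp β)
      (fun x => matOp (V x) - (v₀ : ℂ) • .id ℂ (Spinor d)) C₁ C₃ := by
  have hVs : ∀ x, x ≠ 0 → ∀ k l, ContDiffAt ℝ ∞ (fun y => V y k l) x := fun x hx k l =>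
    (hsm k l).contDiffAt (isOpen_compl_singleton.mem_nhds hx)
  have hVd : ∀ x, x ≠ 0 → ∀ k l, DifferentiableAt ℝ (fun y => V y k l) x := fun x hx k l =>
    (hVs x hx k l).differentiableAt (by simp)
  set B : RSpace d → Spinor d →L[ℂ] Spinor d := fun x => matOp (V x) with hB
  have hBs : ∀ x, x ≠ 0 → ContDiffAt ℝ 1 B x := fun x hx =>
    (contDiffAt_matOp (hVs x hx)).of_le (by simp)
  have hBd : ∀ x, x ≠ 0 → DifferentiableAt ℝ B x := fun x hx =>
    (hBs x hx).differentiableAt (by simp)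
  have hBg : ∀ x, x ≠ 0 → ‖fderiv ℝ B x‖ ≤ C₁ / ‖x‖ ^ 2 := fun x hx =>
    (norm_fderiv_matOp_le (hVd x hx)).trans (hgrad x hx)
  obtain ⟨L, hL⟩ := exists_limit_at_infinity (by omega) hC₁ hBd hBg
  have haa : ∀ j k u, matOp (α j) (matOp (α k) u) + matOp (α k) (matOp (α j) u) =
      if j = k then (2 : ℂ) • u else 0 := by
    intro j k u
    rw [← matOp_mul_apply, ← matOp_mul_apply, ← add_apply, ← map_add, hαβ.alpha_alpha]
    split_ifs <;> simp
  have hab : ∀ j u, matOp (α j) (matOp β u) + matOp β (matOp (α j) u) = 0 := by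
    intro j u
    rw [← matOp_mul_apply, ← matOp_mul_apply, ← add_apply, ← map_add, hαβ.alpha_beta]
    simp
  have hbb : ∀ u : Spinor d, matOp β (matOp β u) = u := by
    intro u
    rw [← matOp_mul_apply, hαβ.beta_sq]
    simp
  -- a point to go to infinity along
  set e : RSpace d := EuclideanSpace.single ⟨0, by omega⟩ 1 with he
  have hen : ‖e‖ = 1 := by simp [he]
  have hn1 : ∀ n : ℕ, (0 : ℝ) < (n : ℝ) + 1 := fun n => by positivity
  set y : ℕ → RSpace d := fun n => ((n : ℝ) + 1) • e with hy
  have hyn : ∀ n, ‖y n‖ = (n : ℝ) + 1 := fun n => by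
    rw [hy, norm_smul, hen, Real.norm_eq_abs, abs_of_pos (hn1 n), mul_one]
  have hy0 : ∀ n, y n ≠ 0 := fun n => norm_pos_iff.1 (by rw [hyn]; exact hn1 n)
  have hlimc : ∀ c : ℝ, Tendsto (fun n : ℕ => c / ((n : ℝ) + 1)) atTop (𝓝 0) := fun c => by
    simpa [div_eq_mul_inv] using (tendsto_one_div_add_atTop_nhds_zero_nat (𝕜 := ℝ)).const_mul c
  have hBL : Tendsto (fun n => B (y n)) atTop (𝓝 L) := by
    rw [tendsto_iff_norm_sub_tendsto_zero]
    refine squeeze_zero (fun n => norm_nonneg _) (fun n => hL _ (hy0 n)) ?_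
    simpa only [hyn] using hlimc C₁
  have hcomm : ∀ A : SpinMat d, Tendsto (fun n => matNorm (A * V (y n) - V (y n) * A)) atTop (𝓝 0) →
      ∀ u, L (matOp A u) = matOp A (L u) := by
    intro A hA
    refine commute_of_tendsto_commutator hBL (tendsto_zero_iff_norm_tendsto_zero.2
      (hA.congr fun n => ?_))
    simp only [matNorm, hB, matOp, map_sub, map_mul]
  -- The commutator bounds enter only through their decay to zero along the sequence `y n`, which
  -- makes `L` commute with every Dirac matrix.
  obtain ⟨c, hc⟩ := eq_smul_of_commute_clifford _ _ haa hab hbb L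
    (fun j => hcomm _ (squeeze_zero (fun n => norm_nonneg _) (fun n => halpha j _ (hy0 n))
      (by simpa only [hyn] using hlimc C₂)))
    (hcomm _ (squeeze_zero (fun n => norm_nonneg _) (fun n => hbeta _ (hy0 n)) (by
      have := (hlimc C₄).mul (hlimc 1)
      rw [mul_zero] at this
      refine this.congr fun n => ?_
      rw [hyn]
      field_simp)))
  have hBsym : ∀ x, x ≠ 0 → ∀ u v, inner ℂ (B x u) v = inner ℂ u (B x v) := fun x hx =>
    matOp_symm (hherm x hx)
  have hcreal : ((c.re : ℝ) : ℂ) = c :=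
    ofReal_re_eq_of_tendsto_symm hBL (fun n => hBsym _ (hy0 n)) hc
  have hLc : L = ((c.re : ℝ) : ℂ) • .id ℂ (Spinor d) := by
    ext1 u
    rw [hcreal, hc]
    rfl
  have hfd : ∀ x, fderiv ℝ (fun x => B x - ((c.re : ℝ) : ℂ) • .id ℂ (Spinor d)) x = fderiv ℝ B x :=
    fun x => by rw [fderiv_sub_const]
  refine ⟨c.re, fun j => matOp_symm (hαβ.alpha_hermitian j), matOp_symm hαβ.beta_hermitian, haa, hab,
    fun x hx => (hBs x hx).sub contDiffAt_const, ?_, ?_, ?_, ?_⟩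
  · intro x hx u v
    have := hBsym x hx u v
    simp only [hB] at this
    simp only [sub_apply, smul_apply, ContinuousLinearMap.id_apply, inner_sub_left, inner_sub_right,
      inner_smul_left, inner_smul_right, Complex.conj_ofReal, this]
  · intro x hx
    rw [← hLc]
    exact hL x hx
  · intro x hx
    rw [hfd]
    refine ((fderiv ℝ B x).le_opNorm x).trans ?_
    refine (mul_le_mul_of_nonneg_right (hBg x hx) (norm_nonneg x)).trans (le_of_eq ?_)
    have := norm_pos_iff.2 hx
    field_simp
  · intro x hx u
    rw [hfd, ← fderiv_anticommutator (hBd x hx)]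
    have hV' : ∀ k l, DifferentiableAt ℝ (fun y => (V y * β + β * V y) k l) x := by
      intro k l
      simp only [Matrix.add_apply, Matrix.mul_apply]
      have := hVd x hx
      fun_prop
    have e1 : (fun y => B y ∘L matOp β + matOp β ∘L B y) =
        fun y => matOp (V y * β + β * V y) := by
      funext y
      simp only [hB, matOp, map_add, map_mul]
      rfl
    rw [e1, ← matOp_eulerD hV']
    exact ((matOp _).le_opNorm u).trans (mul_le_mul_of_nonneg_right (hanti x hx) (norm_nonneg u))

/-! ### Approximating an eigenfunction, and the conclusion -/

/-- For an operator that is not closable `closure` defaults to the operator itself, so the inclusion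
holds without assuming closability. -/
theorem mem_closure_of_mem_graph_closure {E F : Type*} [NormedAddCommGroup E] [NormedSpace ℂ E]
    [NormedAddCommGroup F] [NormedSpace ℂ F] (A : E →ₗ.[ℂ] F) {p : E × F}
    (hp : p ∈ A.closure.graph) : p ∈ closure (A.graph : Set (E × F)) := by
  by_cases hA : A.IsClosable
  · rw [← hA.graph_closure_eq_closure_graph] at hp
    exact hp
  · rw [LinearPMap.closure_def' hA] at hp
    exact subset_closure hp

theorem IsSelfAdjoint.eigenvalue_real {E : Type*} [NormedAddCommGroup E] [InnerProductSpace ℂ E]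
    [CompleteSpace E] {A : E →ₗ.[ℂ] E} (hA : IsSelfAdjoint A) {z : ℂ} {f : A.domain}
    (hf : (f : E) ≠ 0) (hz : A f = z • (f : E)) : ((z.re : ℝ) : ℂ) = z := by
  have h := LinearPMap.adjoint_isFormalAdjoint hA.dense_domain
  rw [LinearPMap.isSelfAdjoint_def.1 hA] at h
  have h1 := h f f
  rw [hz, inner_smul_left, inner_smul_right] at h1
  exact Complex.conj_eq_iff_re.1 (mul_right_cancel₀ (inner_self_ne_zero.2 hf) h1)

/-- Subtracting `v₀` from both the potential and the energy leaves the residual unchanged. -/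
theorem shiftedDirac_eq {d : ℕ} (α : Fin d → SpinMat d) (β : SpinMat d) (m v₀ E : ℝ)
    (V : RSpace d → SpinMat d) (φ : RSpace d → Spinor d) (x : RSpace d) :
    shiftedDirac (fun j => matOp (α j)) (matOp β)
      (fun x => matOp (V x) - (v₀ : ℂ) • .id ℂ (Spinor d)) m (E - v₀) φ x =
      diracExpr α β m V φ x - (E : ℂ) • φ x := by
  simp only [shiftedDirac, kinetic, diracExpr, act, matOp, smul_apply, sub_apply,
    ContinuousLinearMap.id_apply, Finset.smul_sum, Complex.ofReal_sub, sub_smul]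
  abel

theorem l2norm_sub_eq_norm {d : ℕ} {f g : SpinorL2 d} {u : RSpace d → Spinor d}
    (h : u =ᵐ[volume] fun x => f x - g x) : l2norm u = ‖f - g‖ := by
  rw [Lp.norm_def, l2norm]
  congr 1
  exact eLpNorm_congr_ae (h.trans (Lp.coeFn_sub f g).symm)

theorem theorem1p3 (d : ℕ) (hd : 3 ≤ d) (m : ℝ) (hm : 0 < m)
    (α : Fin d → SpinMat d) (β : SpinMat d) (hαβ : IsDiracMatrices α β)
    (V : RSpace d → SpinMat d) (hHS : AssumptionHS α β m V)
    (C₁ C₂ C₃ C₄ : ℝ) (hC₁ : 0 < C₁) (hC₂ : 0 < C₂) (hC₃ : 0 < C₃) (hC₄ : 0 < C₄)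
    (hgrad : ∀ x, x ≠ 0 → gradNorm V x ≤ C₁ / ‖x‖ ^ 2)
    (halpha : ∀ j x, x ≠ 0 → matNorm (α j * V x - V x * α j) ≤ C₂ / ‖x‖)
    (hanti : ∀ x, x ≠ 0 →
      matNorm (eulerD (fun y => V y * β + β * V y) x) ≤ C₃ / ‖x‖ ^ 2)
    (hbeta : ∀ x, x ≠ 0 → matNorm (β * V x - V x * β) ≤ C₄ / ‖x‖ ^ 2)
    (hsmall : 4 * C₁ / ((d : ℝ) - 2) + C₂ + 2 * m * C₄ / ((d : ℝ) - 2)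
      + 2 * m * C₃ / ((d : ℝ) - 2) ^ 2 < 1) :
    pointSpectrum (diracOp α β m V) = ∅ := by
  rw [Set.eq_empty_iff_forall_notMem]
  rintro z ⟨f, hf0, hfz⟩
  have hzr := hHS.selfAdjoint.eigenvalue_real hf0 hfz
  obtain ⟨v₀, hW⟩ := exists_isDecayingDirac hd hαβ hHS.hermitian hHS.smooth hC₁.le hgrad halpha
    hanti hbeta
  have hd' : (0 : ℝ) < (d : ℝ) - 2 := by
    have : (3 : ℝ) ≤ d := by exact_mod_cast hd
    linarith
  -- The `C₂` and `C₄` terms are nonnegative and are dropped.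
  have hsm : 4 * C₁ / ((d : ℝ) - 2) + 2 * m * C₃ / ((d : ℝ) - 2) ^ 2 < 1 := by
    have : 0 ≤ 2 * m * C₄ / ((d : ℝ) - 2) := by positivity
    linarith
  have hcl := mem_closure_of_mem_graph_closure (minimalDirac α β m V)
    (LinearPMap.mem_graph (diracOp α β m V) f)
  rw [minimalDirac_graph, hfz] at hcl
  obtain ⟨p, hp, hlim⟩ := mem_closure_iff_seq_limit.1 hcl
  choose φ hφ hφ1 hφ2 using hp
  have h1 : Tendsto (fun n => (p n).1) atTop (𝓝 (f : SpinorL2 d)) :=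
    (continuous_fst.tendsto _).comp hlim
  have h2 : Tendsto (fun n => (p n).2) atTop (𝓝 (z • (f : SpinorL2 d))) :=
    (continuous_snd.tendsto _).comp hlim
  have hφlim : Tendsto (fun n => l2norm (fun x => φ n x - (f : SpinorL2 d) x)) atTop (𝓝 0) := by
    refine (tendsto_iff_norm_sub_tendsto_zero.1 h1).congr fun n => (l2norm_sub_eq_norm ?_).symm
    filter_upwards [hφ1 n] with x hx
    rw [hx]
  have hTlim : Tendsto (fun n => l2norm (shiftedDirac (fun j => matOp (α j)) (matOp β)
      (fun x => matOp (V x) - (v₀ : ℂ) • .id ℂ (Spinor d)) m (z.re - v₀) (φ n))) atTop (𝓝 0) := by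
    -- Convergence in the graph norm to `(f, z f)` says exactly that the residuals of the
    -- approximating test functions tend to zero.
    have h3 : Tendsto (fun n => ‖(p n).2 - z • (p n).1‖) atTop (𝓝 0) := by
      simpa using (h2.sub (h1.const_smul z)).norm
    refine h3.congr fun n => (l2norm_sub_eq_norm ?_).symm
    filter_upwards [hφ1 n, hφ2 n, Lp.coeFn_smul z (p n).1] with x hx1 hx2 hx3
    rw [shiftedDirac_eq, hzr, hx3, Pi.smul_apply, hx1, hx2]
  have hzero := hW.eq_zero_of_tendsto hd hC₁.le hC₃.le hm.le hsm (z.re - v₀) hφ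
    (Lp.memLp (f : SpinorL2 d)) hφlim hTlim
  exact hf0 (Lp.ext (hzero.trans (Lp.coeFn_zero _ _ _).symm))
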